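/- Let $n\geq 1$. **The poset.** Let $\mathcal T_n$ be the set of pairs $(t,p)$, where $t$ is a total order and $p$ a partial order on $\{1,\dots,n\}$ (both regarded as sets of ordered pairs $i<j$), such that $p\subseteq t$, and such that if $i<j<k$ in $t$ and $i<k$ in $p$ then $i<j$ in $p$. It is partially ordered by: $(t_1,p_1)\leq(t_2,p_2)$ if and only if $p_1\subseteq p_2$ and $t_2\cap t_1^{op}\subseteq p_2$, where $t_1^{op}$ is the reverse of $t_1$. **The configuration space.** $F(n)$ is the space of $n$-tuples of pairwise distinct points of $\mathbb R^2$. **The cell complex.** A *formula of type $n$* is an expression in which each of the symbols $1,\dots,n$ occurs exactly once, built by formal cup products $x\smallsmile y$, which are associative, and formal compositions $i(x_1,\dots,x_k)$, where $k\geq 0$ is called the valence $v_f(i)$ of the symbol $i$ in the formula $f$. If $k=v_f(i)\geq 1$ and $0\leq j\leq k$, let $\partial_{ij}f$ be the formula obtained from $f$ by replacing the part $i(x_1,\dots,x_k)$ by $$\begin{cases} x_1\smallsmile i(x_2,\dots,x_k) & \text{if } j=0,\\ i(x_1,\dots,x_j\smallsmile x_{j+1},\dots,x_k) & \text{if } 0<j<k,\\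 i(x_1,\dots,x_{k-1})\smallsmile x_k & \text{if } j=k.\end{cases}$$ Put $\mathcal F_f=\prod_{i=1}^n\Delta^{v_f(i)}$. The space $\mathcal F(n)$ is the colimit of the cells $\mathcal F_f$ under the face inclusions $\mathcal F_{\partial_{ij}f}\to\mathcal F_f$ (the $j$-th face map $\Delta^{k-1}\to\Delta^{k}$ in the $i$-th factor, the identity in the other factors); that is, it is the quotient of $\coprod_f\mathcal F_f$ in which every point of $\mathcal F_{\partial_{ij}f}$ is identified with its image in $\mathcal F_f$. A *subcomplex* of $\mathcal F(n)$ is a union of images of cells $\mathcal F_f$. **Proposition.** (a) There is a functor $I_n$ from $\mathcal T_n$ to topological spaces, given by subspaces of $F(n)$ and their inclusions, such that (i) the spaces $I_n(t,p)$ are an open cover of $F(n)$, (ii) $F(n)$, with the inclusions, is the colimit of $I_n$, and (iii) each $I_n(t,p)$ is contractible. (b) There is a functor $I'_n$ from $\mathcal T_n$ to topological spaces, given by subspaces of $\mathcal F(n)$ and their inclusions, such that (i) the spaces $I'_n(t,p)$ are subcomplexes of $\mathcal F(n)$ which cover $\mathcal F(n)$, (ii) $\mathcal F(n)$, with the inclusions,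 is the colimit of $I'_n$, and (iii) each $I'_n(t,p)$ is contractible. -/

import Mathlib

namespace FormulaComplex

open CategoryTheory CategoryTheory.Limits

/-! ## The poset of compatible pairs -/

/-- A pair `(t, p)` consisting of a (strict) total order `t` and a (strict) partial order `p` on
the same `n`-element set, such that `p ⊆ t` and such that `i < j < k` in `t` and `i < k` in `p`
imply `i < j` in `p`. -/
@[ext]
structure OrderPair (n : ℕ) where
  t : Fin n → Fin n → Prop
  p : Fin n → Fin n → Prop
  total : IsStrictTotalOrder (Fin n) t
  partialOrd : IsStrictOrder (Fin n) p
  sub : ∀ i j, p i j → t i j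
  consistent : ∀ i j k, t i j → t j k → p i k → p i j

/-- `(t₁, p₁) ≤ (t₂, p₂)` iff `p₁ ⊆ p₂` and `t₂ ∩ t₁ᵒᵖ ⊆ p₂`. -/
instance (n : ℕ) : LE (OrderPair n) where
  le a b := (∀ i j, a.p i j → b.p i j) ∧ (∀ i j, b.t i j → a.t j i → b.p i j)

instance (n : ℕ) : PartialOrder (OrderPair n) where
  le_refl a := ⟨fun _ _ h => h, fun i j h h' =>
    ((have := a.total; irrefl (r := a.t) i) (a.total.trans _ _ _ h h')).elim⟩
  le_trans a b c hab hbc := by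
    refine ⟨fun i j h => hbc.1 _ _ (hab.1 _ _ h), fun i j h h' => ?_⟩
    have := b.total
    rcases trichotomous_of b.t i j with h1 | h1 | h1
    · exact hbc.1 _ _ (hab.2 _ _ h1 h')
    · subst h1
      have := c.total
      exact (irrefl (r := c.t) i h).elim
    · exact hbc.2 _ _ h h1
  le_antisymm a b hab hba := by
    have hp : a.p = b.p := by
      funext i j
      exact propext ⟨hab.1 i j, hba.1 i j⟩
    have key : ∀ {x y : OrderPair n}, x ≤ y → x.p = y.p → ∀ i j, y.t i j → x.t i j := by
      intro x y hxy hp i j h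
      have := x.total
      have := y.total
      rcases trichotomous_of x.t i j with h1 | h1 | h1
      · exact h1
      · subst h1
        exact (irrefl (r := y.t) i h).elim
      · have h2 := hxy.2 i j h h1
        rw [← hp] at h2
        exact (irrefl (r := x.t) i (x.total.trans _ _ _ (x.sub _ _ h2) h1)).elim
    have ht : a.t = b.t := by
      funext i j
      exact propext ⟨key hba hp.symm i j, key hab hp i j⟩
    exact OrderPair.ext ht hp

/-! ## Diagrams of subspaces -/

section Subspaces

variable {P : Type} [PartialOrder P] {X : Type} [TopologicalSpace X]

/-- The functor from a poset to topological spaces given by a monotone family of subspaces of `X`;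
the arrows go to the inclusions. -/
def subspaceFunctor (I : P →o Set X) : P ⥤ TopCat.{0} where
  obj a := TopCat.of (I a)
  map {_ _} f := TopCat.ofHom
    ⟨Set.inclusion (I.monotone (leOfHom f)), continuous_inclusion (I.monotone (leOfHom f))⟩

/-- The inclusions of the subspaces into `X`, as a cocone with vertex `X`. -/
def subspaceCocone (I : P →o Set X) : Cocone (subspaceFunctor I) where
  pt := TopCat.of X
  ι := { app := fun a => TopCat.ofHom ⟨fun x : I a => (x : X), continuous_subtype_val⟩ }

end Subspaces

/-! ## Configuration spaces -/

/-- The space of `n` ordered distinct points of the plane. -/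
abbrev Configuration (n : ℕ) : Type := {x : Fin n → ℝ × ℝ // Function.Injective x}

/-! ## Formulas -/

/-- Expressions built from symbols in `α` by formal cup products and formal operad compositions
`i(x₁, …, x_k)`, modulo associativity of the cup product. Each such expression is uniquely a
nonempty cup product of factors of the form `i(x₁, …, x_k)`, `k ≥ 0`: here `one i [x₁, …, x_k]` is
the single factor `i(x₁, …, x_k)`, and `cup i [x₁, …, x_k] r` is the product
`i(x₁, …, x_k) ⌣ r`. -/
inductive Word (α : Type) : Type
  | one (i : α) (args : List (Word α)) : Word α
  | cup (i : α) (args : List (Word α)) (rest : Word α) : Word α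

namespace Word

variable {α : Type}

/-- The (associative) cup product of two expressions. -/
def append : Word α → Word α → Word α
  | one i args, w => cup i args w
  | cup i args r, w => cup i args (r.append w)

mutual
/-- The symbols occurring in an expression, from left to right. -/
def symbols : Word α → List α
  | one i args => i :: symbolsList args
  | cup i args r => i :: (symbolsList args ++ symbols r)
/-- The symbols occurring in a list of expressions, from left to right. -/
def symbolsList : List (Word α) → List α
  | [] => []
  | w :: ws => symbols w ++ symbolsList ws
end

/-- The list obtained from `[x₁, …, x_k]` by replacing `x_j, x_{j+1}` by `x_j ⌣ x_{j+1}`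
(for `0 < j < k`). -/
def mergeAt : ℕ → List (Word α) → List (Word α)
  | 1, x :: y :: l => x.append y :: l
  | j + 2, x :: l => x :: mergeAt (j + 1) l
  | _, l => l

/-- The `j`-th face (`0 ≤ j ≤ k`) of the factor `i(x₁, …, x_k)`, `k ≥ 1`:
it is `x₁ ⌣ i(x₂, …, x_k)` for `j = 0`, `i(x₁, …, x_j ⌣ x_{j+1}, …, x_k)` for `0 < j < k`, and
`i(x₁, …, x_{k-1}) ⌣ x_k` for `j = k`. (For `k = 0`, where there are no faces, nothing changes.) -/
def expand (i : α) (j : ℕ) : List (Word α) → Word α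
  | [] => one i []
  | x :: l =>
    if j = 0 then x.append (one i l)
    else if j = (x :: l).length then
      cup i (x :: l).dropLast ((x :: l).getLast (List.cons_ne_nil x l))
    else one i (mergeAt j (x :: l))

theorem symbols_append : ∀ x y : Word α, (x.append y).symbols = x.symbols ++ y.symbols
  | one i args, y => by simp [append, symbols]
  | cup i args r, y => by simp [append, symbols, symbols_append r y]

theorem symbolsList_append : ∀ l l' : List (Word α),
    symbolsList (l ++ l') = symbolsList l ++ symbolsList l'
  | [], l' => by simp [symbolsList]
  | x :: l, l' => by simp [symbolsList, symbolsList_append l l']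

theorem symbolsList_mergeAt : ∀ (j : ℕ) (l : List (Word α)),
    symbolsList (mergeAt j l) = symbolsList l
  | 0, l => by simp [mergeAt]
  | 1, [] => by simp [mergeAt]
  | 1, [x] => by simp [mergeAt]
  | 1, x :: y :: l => by simp [mergeAt, symbolsList, symbols_append]
  | j + 2, [] => by simp [mergeAt]
  | j + 2, x :: l => by simp [mergeAt, symbolsList, symbolsList_mergeAt (j + 1) l]

theorem length_mergeAt : ∀ (j : ℕ) (l : List (Word α)), 0 < j → j < l.length →
    (mergeAt j l).length + 1 = l.length
  | 0, l => by simp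
  | 1, [] => by simp
  | 1, [x] => by simp
  | 1, x :: y :: l => by simp [mergeAt]
  | j + 2, [] => by simp
  | j + 2, x :: l => by
    intro _ h
    have := length_mergeAt (j + 1) l (by omega) (by simp at h; omega)
    simp [mergeAt, this]

theorem symbols_expand (i : α) (j : ℕ) : ∀ l : List (Word α),
    (expand i j l).symbols.Perm (i :: symbolsList l)
  | [] => by simp [expand, symbols]
  | x :: l => by
    unfold expand
    dsimp only
    by_cases h1 : j = 0
    · rw [if_pos h1]
      rw [symbols_append]
      simp only [symbols, symbolsList]
      exact List.perm_middle
    rw [if_neg h1]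
    by_cases h2 : j = (x :: l).length
    · rw [if_pos h2]
      simp only [symbols]
      have h := List.dropLast_append_getLast (List.cons_ne_nil x l)
      conv_rhs => rw [← h]
      rw [symbolsList_append]
      simp [symbolsList]
    · rw [if_neg h2]
      simp only [symbols]
      rw [symbolsList_mergeAt]

variable [DecidableEq α]

mutual
/-- The valence of a symbol, that is, its number of formal inputs (summed over its
occurrences). -/
def valence (i : α) : Word α → ℕ
  | one a args => (if a = i then args.length else 0) + valenceList i args
  | cup a args r => (if a = i then args.length else 0) + valenceList i args + valence i r
/-- The valence of a symbol in a list of expressions. -/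
def valenceList (i : α) : List (Word α) → ℕ
  | [] => 0
  | w :: ws => valence i w + valenceList i ws
end

mutual
/-- The expression `∂ᵢⱼ w`, in which the factor `i(x₁, …, x_k)` is replaced by its `j`-th face. -/
def face (i : α) (j : ℕ) : Word α → Word α
  | one a args => if a = i then expand i j args else one a (faceList i j args)
  | cup a args r =>
    if a = i then (expand i j args).append r else cup a (faceList i j args) (face i j r)
/-- `face` applied to every entry of a list. -/
def faceList (i : α) (j : ℕ) : List (Word α) → List (Word α)
  | [] => []
  | w :: ws => face i j w :: faceList i j ws
end

mutual
/-- A face contains the same symbols, with the same multiplicities. -/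
theorem symbols_face (i : α) (j : ℕ) : ∀ w : Word α, (face i j w).symbols.Perm w.symbols
  | one a args => by
    unfold face
    split_ifs with h
    · subst h
      simpa [symbols] using symbols_expand a j args
    · simpa [symbols] using symbolsList_faceList i j args
  | cup a args r => by
    unfold face
    split_ifs with h
    · subst h
      rw [symbols_append]
      simpa [symbols] using (symbols_expand a j args).append_right r.symbols
    · simpa [symbols] using (symbolsList_faceList i j args).append (symbols_face i j r)
theorem symbolsList_faceList (i : α) (j : ℕ) : ∀ l : List (Word α),
    (symbolsList (faceList i j l)).Perm (symbolsList l)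
  | [] => by simp [faceList]
  | w :: ws => by
    simpa [faceList, symbolsList] using
      (symbols_face i j w).append (symbolsList_faceList i j ws)
end

theorem valence_append (l : α) : ∀ x y : Word α,
    valence l (x.append y) = valence l x + valence l y
  | one i args, y => by simp [append, valence]
  | cup i args r, y => by simp [append, valence, valence_append l r y, add_assoc]

theorem valenceList_append (l : α) : ∀ x y : List (Word α),
    valenceList l (x ++ y) = valenceList l x + valenceList l y
  | [], y => by simp [valenceList]
  | w :: x, y => by simp [valenceList, valenceList_append l x y, add_assoc]

theorem valenceList_mergeAt (i : α) : ∀ (j : ℕ) (l : List (Word α)),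
    valenceList i (mergeAt j l) = valenceList i l
  | 0, l => by simp [mergeAt]
  | 1, [] => by simp [mergeAt]
  | 1, [x] => by simp [mergeAt]
  | 1, x :: y :: l => by simp [mergeAt, valenceList, valence_append, add_assoc]
  | j + 2, [] => by simp [mergeAt]
  | j + 2, x :: l => by simp [mergeAt, valenceList, valenceList_mergeAt i (j + 1) l]

theorem valence_expand_of_ne {i l : α} (h : l ≠ i) (j : ℕ) : ∀ args : List (Word α),
    valence l (expand i j args) = valenceList l args
  | [] => by simp [expand, valence, h.symm]
  | x :: xs => by
    unfold expand
    dsimp only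
    by_cases h1 : j = 0
    · rw [if_pos h1]
      simp [valence_append, valence, valenceList, h.symm]
    rw [if_neg h1]
    by_cases h2 : j = (x :: xs).length
    · rw [if_pos h2]
      have h' := List.dropLast_append_getLast (List.cons_ne_nil x xs)
      conv_rhs => rw [← h']
      rw [valenceList_append]
      simp [valence, valenceList, h.symm]
    · rw [if_neg h2]
      simp [valence, valenceList_mergeAt, h.symm]

theorem valence_expand_self (i : α) (j : ℕ) : ∀ args : List (Word α), 0 < args.length →
    j ≤ args.length → valence i (expand i j args) + 1 = args.length + valenceList i args
  | [] => by simp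
  | x :: xs => by
    intro _ hj
    unfold expand
    dsimp only
    by_cases h1 : j = 0
    · rw [if_pos h1]
      simp [valence_append, valence, valenceList]
      omega
    rw [if_neg h1]
    by_cases h2 : j = (x :: xs).length
    · rw [if_pos h2]
      have h' := List.dropLast_append_getLast (List.cons_ne_nil x xs)
      have h3 : valenceList i (x :: xs) = valenceList i (x :: xs).dropLast +
          valence i ((x :: xs).getLast (List.cons_ne_nil x xs)) := by
        conv_lhs => rw [← h']
        rw [valenceList_append]
        simp [valenceList]
      rw [h3]
      simp only [valence, if_true, List.length_dropLast, List.length_cons]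
      omega
    · rw [if_neg h2]
      have := length_mergeAt j (x :: xs) (by omega) (by omega)
      simp only [valence, if_true, valenceList_mergeAt]
      omega

mutual
theorem valence_face_of_ne {i l : α} (h : l ≠ i) (j : ℕ) : ∀ w : Word α,
    valence l (face i j w) = valence l w
  | one a args => by
    unfold face
    split_ifs with h1
    · subst h1
      simp [valence_expand_of_ne h, valence, h.symm]
    · simp [valence, valenceList_faceList_of_ne h j args]
  | cup a args r => by
    unfold face
    split_ifs with h1
    · subst h1
      simp [valence_append, valence_expand_of_ne h, valence, h.symm]
    · simp [valence, valenceList_faceList_of_ne h j args, valence_face_of_ne h j r]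
theorem valenceList_faceList_of_ne {i l : α} (h : l ≠ i) (j : ℕ) : ∀ w : List (Word α),
    valenceList l (faceList i j w) = valenceList l w ∧
      (faceList i j w).length = w.length
  | [] => by simp [faceList]
  | w :: ws => by
    have := valenceList_faceList_of_ne h j ws
    simp [faceList, valenceList, valence_face_of_ne h j w, this]
end

mutual
theorem valence_of_notMem (i : α) : ∀ w : Word α, i ∉ w.symbols → valence i w = 0
  | one a args => by
    intro h
    simp only [symbols, List.mem_cons, not_or] at h
    simp [valence, Ne.symm h.1, valenceList_of_notMem i args h.2]
  | cup a args r => by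
    intro h
    simp only [symbols, List.mem_cons, List.mem_append, not_or] at h
    simp [valence, Ne.symm h.1, valenceList_of_notMem i args h.2.1, valence_of_notMem i r h.2.2]
theorem valenceList_of_notMem (i : α) : ∀ l : List (Word α), i ∉ symbolsList l →
    valenceList i l = 0
  | [] => by simp [valenceList]
  | w :: ws => by
    intro h
    simp only [symbolsList, List.mem_append, not_or] at h
    simp [valenceList, valence_of_notMem i w h.1, valenceList_of_notMem i ws h.2]
end

mutual
theorem face_of_notMem (i : α) (j : ℕ) : ∀ w : Word α, i ∉ w.symbols → face i j w = w
  | one a args => by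
    intro h
    simp only [symbols, List.mem_cons, not_or] at h
    simp [face, Ne.symm h.1, faceList_of_notMem i j args h.2]
  | cup a args r => by
    intro h
    simp only [symbols, List.mem_cons, List.mem_append, not_or] at h
    simp [face, Ne.symm h.1, faceList_of_notMem i j args h.2.1, face_of_notMem i j r h.2.2]
theorem faceList_of_notMem (i : α) (j : ℕ) : ∀ l : List (Word α), i ∉ symbolsList l →
    faceList i j l = l
  | [] => by simp [faceList]
  | w :: ws => by
    intro h
    simp only [symbolsList, List.mem_append, not_or] at h
    simp [faceList, face_of_notMem i j w h.1, faceList_of_notMem i j ws h.2]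
end

mutual
theorem valence_face_self (i : α) (j : ℕ) : ∀ w : Word α, w.symbols.count i = 1 →
    0 < valence i w → j ≤ valence i w → valence i (face i j w) + 1 = valence i w
  | one a args => by
    intro h hv hj
    by_cases h1 : a = i
    · subst h1
      have h2 : a ∉ symbolsList args := by
        simp only [symbols, List.count_cons_self, Nat.add_eq_right] at h
        exact List.count_eq_zero.1 h
      have h3 := valenceList_of_notMem a args h2
      simp only [valence, if_true, h3, add_zero] at hv hj
      have h4 := valence_expand_self a j args hv hj
      simpa [face, valence] using h4
    · rw [symbols, List.count_cons_of_ne h1] at h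
      simp only [valence, if_neg h1, zero_add] at hv hj
      simpa [face, valence, h1] using valenceList_faceList_self i j args h hv hj
  | cup a args r => by
    intro h hv hj
    by_cases h1 : a = i
    · subst h1
      simp only [symbols, List.count_cons_self, Nat.add_eq_right] at h
      have h2 := List.count_eq_zero.1 h
      simp only [List.mem_append, not_or] at h2
      have h3 := valenceList_of_notMem a args h2.1
      have h5 := valence_of_notMem a r h2.2
      simp only [valence, if_true, h3, h5, add_zero] at hv hj
      have h4 := valence_expand_self a j args hv hj
      simp only [face, if_true, valence_append, valence, h5]
      omega
    · rw [symbols, List.count_cons_of_ne h1, List.count_append] at h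
      simp only [valence, if_neg h1, zero_add] at hv hj
      simp only [face, if_neg h1, valence, zero_add]
      rcases Nat.eq_zero_or_pos (List.count i (symbolsList args)) with h2 | h2
      · have h3 := List.count_eq_zero.1 h2
        have h4 := valenceList_of_notMem i args h3
        have := valence_face_self i j r (by omega) (by omega) (by omega)
        rw [faceList_of_notMem i j args h3]
        omega
      · have h3 : i ∉ r.symbols := List.count_eq_zero.1 (by omega)
        have h4 := valence_of_notMem i r h3
        have := valenceList_faceList_self i j args (by omega) (by omega) (by omega)
        rw [face_of_notMem i j r h3]
        omega
theorem valenceList_faceList_self (i : α) (j : ℕ) : ∀ l : List (Word α),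
    (symbolsList l).count i = 1 → 0 < valenceList i l → j ≤ valenceList i l →
    valenceList i (faceList i j l) + 1 = valenceList i l
  | [] => by simp [valenceList]
  | w :: ws => by
    intro h hv hj
    rw [symbolsList, List.count_append] at h
    simp only [valenceList] at hv hj
    simp only [faceList, valenceList]
    rcases Nat.eq_zero_or_pos (List.count i w.symbols) with h2 | h2
    · have h3 := List.count_eq_zero.1 h2
      have h4 := valence_of_notMem i w h3
      have := valenceList_faceList_self i j ws (by omega) (by omega) (by omega)
      rw [face_of_notMem i j w h3]
      omega
    · have h3 : i ∉ symbolsList ws := List.count_eq_zero.1 (by omega)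
      have h4 := valenceList_of_notMem i ws h3
      have := valence_face_self i j w (by omega) (by omega) (by omega)
      rw [faceList_of_notMem i j ws h3]
      omega
end

end Word

/-- A formula of type `n`: an expression in which each of `n` given symbols occurs exactly
once. -/
structure Formula (n : ℕ) where
  word : Word (Fin n)
  once : ∀ i, word.symbols.count i = 1

namespace Formula

variable {n : ℕ}

/-- The valence of the symbol `i` in a formula. -/
def valence (f : Formula n) (i : Fin n) : ℕ := f.word.valence i

/-- The face `∂ᵢⱼ f` (to be used for `0 < f.valence i` and `0 ≤ j ≤ f.valence i`). -/
def face (f : Formula n) (i : Fin n) (j : ℕ) : Formula n where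
  word := f.word.face i j
  once k := by rw [(Word.symbols_face i j f.word).count_eq, f.once]

/-- The cell of a formula: the product over all symbols `i` of the standard simplices of
dimension `f.valence i`. -/
abbrev Cell (f : Formula n) : Type :=
  ∀ i : Fin n, stdSimplex ℝ (Fin (f.valence i + 1))

theorem valence_face (f : Formula n) (i l : Fin n) (hi : 0 < f.valence i)
    (j : Fin (f.valence i + 1)) :
    f.valence l = (f.face i j).valence l + if l = i then 1 else 0 := by
  unfold valence face
  by_cases h : l = i
  · subst h
    have := Word.valence_face_self l j f.word (f.once l) hi (by have := j.2; unfold valence at this; omega)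
    simp [this]
  · simp [h, Word.valence_face_of_ne h]

/-- The map of vertices underlying the inclusion of the face `∂ᵢⱼ f`: in the coordinate `i` it is
the increasing map that omits the vertex `j`, in all other coordinates it is the identity. -/
def faceVertex (f : Formula n) (i : Fin n) (hi : 0 < f.valence i) (j : Fin (f.valence i + 1))
    (l : Fin n) (m : Fin ((f.face i j).valence l + 1)) : Fin (f.valence l + 1) :=
  ⟨if l = i ∧ (j : ℕ) ≤ m then m + 1 else m, by
    have h := f.valence_face i l hi j
    have := m.2
    by_cases hl : l = i
    · simp only [hl, if_true, true_and] at h ⊢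
      subst hl
      split_ifs <;> omega
    · simp only [hl, if_false, false_and, add_zero] at h ⊢
      omega⟩

/-- The inclusion of the cell of `∂ᵢⱼ f` into the cell of `f`: the product of the `j`-th face map
in the coordinate `i` with identity maps. -/
noncomputable def faceMap (f : Formula n) (i : Fin n) (hi : 0 < f.valence i)
    (j : Fin (f.valence i + 1)) (x : (f.face i j).Cell) : f.Cell :=
  fun l => stdSimplex.map (f.faceVertex i hi j l) (x l)

end Formula

/-! ## The cell complex -/

/-- Every point of the cell of `∂ᵢⱼ f` is identified with its image in the cell of `f`. -/
inductive Glue (n : ℕ) : (Σ f : Formula n, f.Cell) → (Σ f : Formula n, f.Cell) → Prop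
  | face (f : Formula n) (i : Fin n) (hi : 0 < f.valence i) (j : Fin (f.valence i + 1))
      (x : (f.face i j).Cell) : Glue n ⟨f.face i j, x⟩ ⟨f, f.faceMap i hi j x⟩

/-- The cell complex `𝓕(n)`: the colimit, in topological spaces, of the cells of the formulas of
type `n` along the inclusions of faces, that is, the disjoint union of the cells modulo the
equivalence relation generated by `Glue n`, with the quotient topology. -/
def Complex (n : ℕ) : Type := Quot (Glue n)

instance (n : ℕ) : TopologicalSpace (Complex n) :=
  inferInstanceAs (TopologicalSpace (Quot (Glue n)))

/-- The closed cell of a formula in the cell complex. -/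
def closedCell {n : ℕ} (f : Formula n) : Set (Complex n) :=
  Set.range fun x : f.Cell => (Quot.mk (Glue n) ⟨f, x⟩ : Complex n)

/-- A subcomplex is a union of closed cells (which contain all of their faces). -/
def IsSubcomplex {n : ℕ} (A : Set (Complex n)) : Prop :=
  ∃ S : Set (Formula n), A = ⋃ f ∈ S, closedCell f

end FormulaComplex

/-!
The configuration space and the cell complex are treated in parallel: each point lies in a smallest
member of the family of subspaces, so that the colimit statement reduces to the fact that
continuity can be tested on the members (`isColimit_subspaceCocone`).

In the configuration space, the open set `region (t, p)` consists of the configurations such that,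
for `i < j` in `t`, the second coordinates of the points `i` and `j` increase, or else `i < j` in
`p` and the point `j` is not on the horizontal ray to the left of the point `i`. The smallest such
set containing a given configuration belongs to the lexicographic order
(`Configuration.orderPair`). The set is contractible: the first coordinates can be moved linearly
to values that increase along `t`, and after that the remaining conditions on the second
coordinates are convex.

In the cell complex, a formula is encoded by the sequence in which `i(x₁, …, x_k)` is written as
`i X₁ i X₂ i ⋯ i X_k i`. The `k + 1` occurrences of `i` are the vertices of the simplex of `i`, a
face deletes one occurrence (`Word.enc_face`), and the sequences that occur are those without
repetitions of neighbours and without interlacing `a ⋯ b ⋯ a ⋯ b` (`Word.isFormal_enc`,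
`Word.exists_enc`). A point of a cell attaches a weight to each entry of the sequence; removing the
entries of weight `0` gives a normal form, which is a complete invariant of the points of the
complex (`Complex.normalForm_injective`). Hence maps out of a subcomplex can be defined on normal
forms, and their continuity can be tested on the cells of the subcomplex
(`OrderPair.continuous_of_cells`).

The subcomplex of `(t, p)` consists of the cells of the formulas `f` whose own order pair (order of
the symbols as written, and nesting) is at most `(t, p)`. It is contractible by induction on the
number of symbols. Let `m` be the first symbol of `t`. It is never nested in another symbol, and
the symbols to its left are above `m` in `p`, so they may be moved inside `m`: every cell is
contained in a cell of the subcomplex whose sequence starts with `m`, and there the barycentric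
coordinates of `m` can be moved linearly to the first vertex (`OrderPair.IsFirst.exists_homotopy`).
At the end of this deformation a point is of the form `m ⌣ y`, where `y` is obtained by removing
`m`. Thus the identity is homotopic to a map that factors through the subcomplex of the restriction
of `(t, p)` to the other symbols.
-/

namespace FormulaComplex

open CategoryTheory CategoryTheory.Limits

/-! ### Words as sequences of symbols -/

namespace Word

variable {α : Type}

mutual
/-- The sequence of symbols of an expression: the factor `i(x₁, …, x_k)` is written as
`i X₁ i X₂ i ⋯ i X_k i`, where `X_m` is the sequence of `x_m`. The `k + 1` occurrences of `i`
correspond to the vertices of the simplex of `i`, and a face deletes one of them. -/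
def enc : Word α → List α
  | one i args => i :: encArgs i args
  | cup i args r => i :: (encArgs i args ++ enc r)
/-- The sequence `X₁ i X₂ i ⋯ X_k i` of a list of arguments of the symbol `i`. -/
def encArgs (i : α) : List (Word α) → List α
  | [] => []
  | x :: xs => enc x ++ i :: encArgs i xs
end

/-- The leftmost symbol of an expression. -/
def head : Word α → α
  | one i _ => i
  | cup i _ _ => i

/-- Insert an additional first argument into the leftmost factor of an expression. -/
def consArg (x : Word α) : Word α → Word α
  | one i args => one i (x :: args)
  | cup i args r => cup i (x :: args) r

theorem enc_append : ∀ x y : Word α, (x.append y).enc = x.enc ++ y.enc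
  | one i args, y => by simp [append, enc]
  | cup i args r, y => by simp [append, enc, enc_append r y]

theorem enc_consArg (x w : Word α) : (consArg x w).enc = w.head :: (x.enc ++ w.enc) := by
  cases w <;> simp [consArg, enc, encArgs, head]

theorem symbols_consArg_perm (x w : Word α) :
    (consArg x w).symbols.Perm (x.symbols ++ w.symbols) := by
  cases w
  · simp only [consArg, symbols, symbolsList]
    exact List.perm_middle.symm
  · simp only [consArg, symbols, symbolsList, List.append_assoc]
    exact List.perm_middle.symm

theorem enc_eq_cons (w : Word α) : ∃ l, w.enc = w.head :: l := by
  cases w <;> simp [enc, head]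

theorem head_mem_enc (w : Word α) : w.head ∈ w.enc := by
  cases w <;> simp [enc, head]

theorem enc_ne_nil (w : Word α) : w.enc ≠ [] := by
  cases w <;> simp [enc]

mutual
/-- Induction on expressions that adds the arguments of the leftmost factor one at a time. -/
theorem consInduction {P : Word α → Prop} (h1 : ∀ i, P (one i []))
    (h2 : ∀ i r, P r → P (cup i [] r)) (h3 : ∀ x w, P x → P w → P (consArg x w)) :
    ∀ w, P w
  | one i args => consInduction_one h1 h2 h3 i args
  | cup i args r => consInduction_cup h1 h2 h3 i args r (consInduction h1 h2 h3 r)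
theorem consInduction_one {P : Word α → Prop} (h1 : ∀ i, P (one i []))
    (h2 : ∀ i r, P r → P (cup i [] r)) (h3 : ∀ x w, P x → P w → P (consArg x w)) (i : α) :
    ∀ args, P (one i args)
  | [] => h1 i
  | x :: args => h3 x (one i args) (consInduction h1 h2 h3 x) (consInduction_one h1 h2 h3 i args)
theorem consInduction_cup {P : Word α → Prop} (h1 : ∀ i, P (one i []))
    (h2 : ∀ i r, P r → P (cup i [] r)) (h3 : ∀ x w, P x → P w → P (consArg x w)) (i : α) :
    ∀ args r, P r → P (cup i args r)
  | [], r, hr => h2 i r hr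
  | x :: args, r, hr => h3 x (cup i args r) (consInduction h1 h2 h3 x)
      (consInduction_cup h1 h2 h3 i args r hr)
end

theorem mem_enc {w : Word α} {j : α} : j ∈ w.enc ↔ j ∈ w.symbols := by
  induction w using consInduction with
  | h1 i => simp [enc, encArgs, symbols, symbolsList]
  | h2 i r hr => simp [enc, encArgs, symbols, symbolsList, hr]
  | h3 x w hx hw =>
    rw [enc_consArg, (symbols_consArg_perm x w).mem_iff]
    simp only [List.mem_cons, List.mem_append, hx, hw]
    constructor
    · rintro (rfl | h)
      · exact Or.inr (hw.1 w.head_mem_enc)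
      · exact h
    · exact Or.inr

theorem mem_encArgs {i j : α} : ∀ {l : List (Word α)}, j ∈ encArgs i l →
    j = i ∨ j ∈ symbolsList l
  | [], h => by simp [encArgs] at h
  | x :: l, h => by
    simp only [encArgs, List.mem_append, List.mem_cons, symbolsList] at h ⊢
    rcases h with h | h | h
    · exact Or.inr (Or.inl (mem_enc.1 h))
    · exact Or.inl h
    · exact (mem_encArgs h).imp id Or.inr

theorem nodup_consArg {x w : Word α} : (consArg x w).symbols.Nodup ↔
    x.symbols.Nodup ∧ w.symbols.Nodup ∧ ∀ j ∈ x.enc, j ∉ w.enc := by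
  rw [(symbols_consArg_perm x w).nodup_iff, List.nodup_append']
  simp only [mem_enc, List.Disjoint]

theorem nodup_cup_nil {i : α} {r : Word α} : (cup i [] r).symbols.Nodup ↔
    i ∉ r.enc ∧ r.symbols.Nodup := by
  simp [symbols, symbolsList, mem_enc]

/-- A sequence in which no two symbols interlace as `a ⋯ b ⋯ a ⋯ b` and no two neighbours
coincide. These are exactly the sequences of expressions without repeated symbols. -/
structure IsFormal (l : List α) : Prop where
  ne_nil : l ≠ []
  chain : l.IsChain (· ≠ ·)
  noncrossing : ∀ a b, a ≠ b → ¬ [a, b, a, b].Sublist l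

theorem sublist_four_append {a b c d : α} {l r : List α} (h : [a, b, c, d].Sublist (l ++ r)) :
    [a, b, c, d].Sublist l ∨ ([a, b, c].Sublist l ∧ [d].Sublist r) ∨
    ([a, b].Sublist l ∧ [c, d].Sublist r) ∨ ([a].Sublist l ∧ [b, c, d].Sublist r) ∨
    [a, b, c, d].Sublist r := by
  obtain ⟨l₁, l₂, h, h₁, h₂⟩ := List.sublist_append_iff.1 h
  rcases l₁ with _ | ⟨_, _ | ⟨_, _ | ⟨_, _ | ⟨_, _ | _⟩⟩⟩⟩ <;> simp at h <;> simp_all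

theorem sublist_three_append {a b c : α} {l r : List α} (h : [a, b, c].Sublist (l ++ r)) :
    [a, b, c].Sublist l ∨ ([a, b].Sublist l ∧ [c].Sublist r) ∨
    ([a].Sublist l ∧ [b, c].Sublist r) ∨ [a, b, c].Sublist r := by
  obtain ⟨l₁, l₂, h, h₁, h₂⟩ := List.sublist_append_iff.1 h
  rcases l₁ with _ | ⟨_, _ | ⟨_, _ | ⟨_, _ | _⟩⟩⟩ <;> simp at h <;> simp_all

theorem isFormal_enc {w : Word α} (hw : w.symbols.Nodup) : IsFormal w.enc := by
  induction w using consInduction with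
  | h1 i =>
    refine ⟨by simp [enc], by simp [enc, encArgs], fun a b hab h => ?_⟩
    have := h.length_le
    simp [enc, encArgs] at this
  | h2 i r hr =>
    rw [nodup_cup_nil] at hw
    have hr := hr hw.2
    refine ⟨by simp [enc], ?_, fun a b hab h => ?_⟩
    · simp only [enc, encArgs, List.nil_append, List.isChain_cons]
      refine ⟨fun y hy h => ?_, hr.chain⟩
      subst h
      exact hw.1 (List.mem_of_mem_head? hy)
    · simp only [enc, encArgs, List.nil_append] at h
      rcases List.sublist_cons_iff.1 h with h | ⟨s, h, h'⟩
      · exact hr.noncrossing a b hab h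
      · simp only [List.cons.injEq] at h
        obtain ⟨rfl, rfl⟩ := h
        exact hw.1 (h'.subset (by simp))
  | h3 x w hx ih =>
    obtain ⟨nx, nw, hd⟩ := nodup_consArg.1 hw
    have hx := hx nx
    have ih := ih nw
    have hh : w.head ∉ x.enc := fun h => hd _ h w.head_mem_enc
    obtain ⟨l, hl⟩ := w.enc_eq_cons
    rw [enc_consArg]
    refine ⟨by simp, ?_, fun a b hab h => ?_⟩
    · rw [List.isChain_cons, List.isChain_append]
      refine ⟨fun y hy h => ?_, hx.chain, ih.chain, fun y hy z hz h => ?_⟩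
      · subst h
        rw [List.head?_append_of_ne_nil _ x.enc_ne_nil] at hy
        exact hh (List.mem_of_mem_head? hy)
      · subst h
        exact hd _ (List.mem_of_mem_getLast? hy) (List.mem_of_mem_head? hz)
    · rcases List.sublist_cons_iff.1 h with h | ⟨s, h, h'⟩
      · rcases sublist_four_append h with h | ⟨h, h'⟩ | ⟨h, h'⟩ | ⟨h, h'⟩ | h
        · exact hx.noncrossing a b hab h
        · exact hd b (h.subset (by simp)) (h'.subset (by simp))
        · exact hd b (h.subset (by simp)) (h'.subset (by simp))
        · exact hd a (h.subset (by simp)) (h'.subset (by simp))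
        · exact ih.noncrossing a b hab h
      · simp only [List.cons.injEq] at h
        obtain ⟨rfl, rfl⟩ := h
        rcases sublist_three_append h' with h | ⟨h, h'⟩ | ⟨h, h'⟩ | h
        · exact hh (h.subset (by simp))
        · exact hh (h.subset (by simp))
        · exact hd b (h.subset (by simp)) (h'.subset (by simp))
        · refine ih.noncrossing _ b hab ?_
          rw [hl] at h ⊢
          rcases List.sublist_cons_iff.1 h with h | ⟨s, h, h'⟩
          · exact h.cons_cons _
          · simp only [List.cons.injEq] at h
            exact (hab h.1.symm).elim

theorem append_cons_inj_of_notMem {i : α} : ∀ {x y l r : List α}, i ∉ x → i ∉ y →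
    x ++ i :: l = y ++ i :: r → x = y ∧ l = r
  | [], [], l, r, _, _, h => by simpa using h
  | [], b :: y, l, r, _, hy, h => by simp at h; simp [h.1] at hy
  | a :: x, [], l, r, hx, _, h => by simp at h; simp [h.1] at hx
  | a :: x, b :: y, l, r, hx, hy, h => by
    simp only [List.cons_append, List.cons.injEq] at h
    have := append_cons_inj_of_notMem (fun h => hx (List.mem_cons_of_mem _ h))
      (fun h => hy (List.mem_cons_of_mem _ h)) h.2
    simp [h.1, this]

theorem cases_cons (w : Word α) :
    (∃ i, w = one i []) ∨ (∃ i r, w = cup i [] r) ∨ ∃ x v, w = consArg x v := by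
  rcases w with ⟨i, _ | ⟨x, l⟩⟩ | ⟨i, _ | ⟨x, l⟩, r⟩
  · exact Or.inl ⟨i, rfl⟩
  · exact Or.inr (Or.inr ⟨x, one i l, rfl⟩)
  · exact Or.inr (Or.inl ⟨i, r, rfl⟩)
  · exact Or.inr (Or.inr ⟨x, cup i l r, rfl⟩)

theorem notMem_tail_of_consArg {x w : Word α} (h : (consArg x w).symbols.Nodup) :
    w.head ∉ x.enc := fun h' => (nodup_consArg.1 h).2.2 _ h' w.head_mem_enc

/-- An expression without repeated symbols is determined by its sequence. -/
theorem enc_injective {w : Word α} (hw : w.symbols.Nodup) :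
    ∀ {v : Word α}, v.symbols.Nodup → w.enc = v.enc → w = v := by
  induction w using consInduction with
  | h1 i =>
    intro v hv h
    rcases v.cases_cons with ⟨j, rfl⟩ | ⟨j, r, rfl⟩ | ⟨y, u, rfl⟩
    · simpa [enc, encArgs] using h
    · have := r.enc_ne_nil
      simp [enc, encArgs, this.symm] at h
    · have := y.enc_ne_nil
      simp [enc_consArg, enc, encArgs, this] at h
  | h2 i r hr =>
    intro v hv h
    rw [nodup_cup_nil] at hw
    rcases v.cases_cons with ⟨j, rfl⟩ | ⟨j, r, rfl⟩ | ⟨y, u, rfl⟩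
    · have := r.enc_ne_nil
      simp [enc, encArgs, this] at h
    · simp only [enc, encArgs, List.nil_append, List.cons.injEq] at h
      rw [h.1, hr hw.2 (nodup_cup_nil.1 hv).2 h.2]
    · simp only [enc_consArg, enc, encArgs, List.nil_append, List.cons.injEq] at h
      refine (hw.1 ?_).elim
      rw [h.1, h.2]
      exact List.mem_append_right _ u.head_mem_enc
  | h3 x w hx ih =>
    intro v hv h
    have hh := notMem_tail_of_consArg hw
    rcases v.cases_cons with ⟨j, rfl⟩ | ⟨j, r, rfl⟩ | ⟨y, u, rfl⟩
    · have := x.enc_ne_nil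
      simp [enc_consArg, enc, encArgs, this] at h
    · simp only [enc_consArg, enc, encArgs, List.nil_append, List.cons.injEq] at h
      refine ((nodup_cup_nil.1 hv).1 ?_).elim
      rw [← h.1, ← h.2]
      exact List.mem_append_right _ w.head_mem_enc
    · have hh' := notMem_tail_of_consArg hv
      obtain ⟨nx, nw, -⟩ := nodup_consArg.1 hw
      obtain ⟨ny, nu, -⟩ := nodup_consArg.1 hv
      simp only [enc_consArg, List.cons.injEq] at h
      obtain ⟨h0, h⟩ := h
      obtain ⟨l, hl⟩ := w.enc_eq_cons
      obtain ⟨r, hr⟩ := u.enc_eq_cons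
      rw [hl, hr, ← h0] at h
      obtain ⟨h1, h2⟩ := append_cons_inj_of_notMem hh (h0 ▸ hh') h
      rw [hx nx ny h1, ih nw nu (by rw [hl, hr, h0, h2])]

theorem exists_enc_aux [DecidableEq α] : ∀ (k : ℕ) (l : List α), l.length ≤ k → IsFormal l →
    ∃ w : Word α, w.symbols.Nodup ∧ w.enc = l := by
  intro k
  induction k with
  | zero => intro l hl h; exact (h.ne_nil (List.eq_nil_of_length_eq_zero (by omega))).elim
  | succ k ih =>
    intro l hl h
    rcases l with _ | ⟨i, l⟩
    · exact (h.ne_nil rfl).elim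
    by_cases hi : i ∈ l
    -- The part up to the next occurrence of `i` is the first argument of `i`.
    · obtain ⟨x, r, rfl, hx⟩ := List.eq_append_cons_of_mem hi
      have hx0 : x ≠ [] := by
        rintro rfl
        have := h.chain
        simp at this
      have hs : (i :: r).Sublist (i :: (x ++ i :: r)) :=
        (List.sublist_append_right x (i :: r)).cons _
      have hs' : x.Sublist (i :: (x ++ i :: r)) := (List.sublist_append_left x _).cons _
      have hc := (List.isChain_append.1 (List.isChain_cons.1 h.chain).2)
      simp only [List.length_cons, List.length_append] at hl
      obtain ⟨w, nw, hw⟩ := ih (i :: r) (by simp; omega)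
        ⟨by simp, hc.2.1, fun a b hab h' => h.noncrossing a b hab (h'.trans hs)⟩
      obtain ⟨y, ny, hy⟩ := ih x (by omega)
        ⟨hx0, hc.1, fun a b hab h' => h.noncrossing a b hab (h'.trans hs')⟩
      have hwi : w.head = i := by
        obtain ⟨l, hl⟩ := w.enc_eq_cons
        rw [hl] at hw
        simp only [List.cons.injEq] at hw
        exact hw.1
      refine ⟨consArg y w, nodup_consArg.2 ⟨ny, nw, fun j hj hj' => ?_⟩, ?_⟩
      · rw [hy] at hj
        rw [hw] at hj'
        have hji : j ≠ i := by rintro rfl; exact hx hj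
        have hj' := (List.mem_cons.1 hj').resolve_left hji
        refine h.noncrossing i j hji.symm ?_
        refine List.Sublist.cons_cons _ ?_
        exact (List.singleton_sublist.2 hj).append
          ((List.singleton_sublist.2 hj').cons_cons i)
      · rw [enc_consArg, hwi, hy, hw]
    · rcases l with _ | ⟨j, l⟩
      · exact ⟨one i [], by simp [symbols, symbolsList], by simp [enc, encArgs]⟩
      · obtain ⟨w, nw, hw⟩ := ih (j :: l) (by simpa using hl)
          ⟨by simp, (List.isChain_cons.1 h.chain).2,
            fun a b hab h' => h.noncrossing a b hab (h'.cons _)⟩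
        exact ⟨cup i [] w, nodup_cup_nil.2 ⟨by rwa [hw], nw⟩, by simp [enc, encArgs, hw]⟩

/-- Every sequence without interlacing symbols and equal neighbours comes from an expression. -/
theorem exists_enc [DecidableEq α] {l : List α} (h : IsFormal l) :
    ∃ w : Word α, w.symbols.Nodup ∧ w.enc = l :=
  exists_enc_aux _ l le_rfl h

theorem expand_add_two (i : α) (j : ℕ) (x y : Word α) (l : List (Word α)) :
    expand i (j + 2) (x :: y :: l) = consArg x (expand i (j + 1) (y :: l)) := by
  simp only [expand, List.length_cons, Nat.add_eq_zero_iff, OfNat.ofNat_ne_zero, and_false,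
    if_false, one_ne_zero, Nat.add_right_cancel_iff]
  by_cases h : j = l.length
  · simp [h, consArg]
  · rw [if_neg (by omega), if_neg (by omega)]
    simp [mergeAt, consArg]

theorem head_expand_succ (i : α) (j : ℕ) : ∀ l : List (Word α), (expand i (j + 1) l).head = i
  | [] => by simp [expand, head]
  | x :: l => by
    simp only [expand]
    split_ifs <;> simp_all [head]

variable [DecidableEq α]

theorem count_enc (i : α) (w : Word α) :
    w.enc.count i = w.valence i + w.symbols.count i := by
  induction w using consInduction with
  | h1 a => simp [enc, encArgs, symbols, symbolsList, valence, valenceList]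
  | h2 a r hr =>
    simp only [enc, encArgs, symbols, symbolsList, valence, valenceList, List.nil_append,
      List.count_cons, hr, List.length_nil]
    split_ifs <;> omega
  | h3 x w hx hw =>
    rw [enc_consArg, (symbols_consArg_perm x w).count_eq, List.count_cons, List.count_append,
      List.count_append, hx, hw]
    rcases w with ⟨a, l⟩ | ⟨a, l, r⟩
    all_goals
      simp only [head, consArg, valence, valenceList, List.length_cons, beq_iff_eq]
      split_ifs <;> omega

/-- Delete the `j`-th occurrence (counted from `0`) of `i` in a sequence. -/
def delOcc (i : α) : ℕ → List α → List α
  | _, [] => []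
  | 0, a :: l => if a = i then l else a :: delOcc i 0 l
  | j + 1, a :: l => if a = i then a :: delOcc i j l else a :: delOcc i (j + 1) l

theorem delOcc_cons_self_zero (i : α) (l : List α) : delOcc i 0 (i :: l) = l := by
  simp [delOcc]

theorem delOcc_cons_self_succ (i : α) (j : ℕ) (l : List α) :
    delOcc i (j + 1) (i :: l) = i :: delOcc i j l := by
  simp [delOcc]

theorem delOcc_cons_of_ne {i a : α} (h : a ≠ i) (j : ℕ) (l : List α) :
    delOcc i j (a :: l) = a :: delOcc i j l := by
  cases j <;> simp [delOcc, h]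

theorem delOcc_append_of_notMem {i : α} (j : ℕ) : ∀ {x : List α} (l : List α), i ∉ x →
    delOcc i j (x ++ l) = x ++ delOcc i j l
  | [], l, _ => rfl
  | a :: x, l, h => by
    simp only [List.mem_cons, not_or] at h
    rw [List.cons_append, delOcc_cons_of_ne (Ne.symm h.1), delOcc_append_of_notMem j l h.2,
      List.cons_append]

theorem delOcc_append_of_lt {i : α} : ∀ {j : ℕ} {x : List α} (l : List α), j < x.count i →
    delOcc i j (x ++ l) = delOcc i j x ++ l
  | j, [], l, h => by simp at h
  | j, a :: x, l, h => by
    by_cases ha : a = i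
    · subst ha
      cases j with
      | zero => simp [delOcc]
      | succ j =>
        rw [List.count_cons_self] at h
        have h' : j < x.count a := by omega
        simp [delOcc, delOcc_append_of_lt l h']
    · rw [List.count_cons_of_ne ha] at h
      simp [delOcc_cons_of_ne ha, delOcc_append_of_lt l h]

theorem delOcc_sublist (i : α) : ∀ (j : ℕ) (l : List α), (delOcc i j l).Sublist l
  | j, [] => by simp [delOcc]
  | j, a :: l => by
    by_cases ha : a = i
    · subst ha
      cases j with
      | zero => simp [delOcc]
      | succ j => simpa [delOcc] using delOcc_sublist a j l
    · simpa [delOcc_cons_of_ne ha] using delOcc_sublist i j l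

theorem enc_expand (i : α) : ∀ (j : ℕ) (l : List (Word α)), 0 < l.length → j ≤ l.length →
    i ∉ symbolsList l → (expand i j l).enc = delOcc i j (enc (one i l))
  | j, [] => by simp
  | 0, x :: l => by
    intro _ _ _
    simp [expand, enc_append, enc, encArgs, delOcc]
  | 1, [x] => by
    intro _ _ h
    simp only [symbolsList, List.append_nil, ← mem_enc] at h
    simp [expand, enc, encArgs, delOcc, delOcc_append_of_notMem 0 [i] h]
  | 1, x :: y :: l => by
    intro _ _ h
    simp only [symbolsList, List.mem_append, not_or, ← mem_enc] at h
    simp [expand, mergeAt, enc, encArgs, delOcc, enc_append, delOcc_append_of_notMem 0 _ h.1]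
  | j + 2, [x] => by simp
  | j + 2, x :: y :: l => by
    intro _ h' h
    have h0 := h
    rw [symbolsList, List.mem_append, not_or, ← mem_enc] at h
    rw [expand_add_two, enc_consArg, head_expand_succ,
      enc_expand i (j + 1) (y :: l) (by simp) (by simpa using h') h.2]
    have : enc (one i (x :: y :: l)) = i :: (x.enc ++ enc (one i (y :: l))) := by
      simp [enc, encArgs]
    rw [this, delOcc_cons_self_succ, delOcc_append_of_notMem _ _ h.1]

theorem count_enc_pos_of_mem {i : α} {w : Word α} (h : w.symbols.count i = 1) :
    w.enc.count i = w.valence i + 1 := by rw [count_enc, h]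

mutual
/-- A face deletes an occurrence of a symbol from the sequence. -/
theorem enc_face (i : α) (j : ℕ) : ∀ w : Word α, w.symbols.count i = 1 →
    0 < valence i w → j ≤ valence i w → (face i j w).enc = delOcc i j w.enc
  | one a args => by
    intro h hv hj
    by_cases h1 : a = i
    · subst h1
      have h2 : a ∉ symbolsList args := by
        simp only [symbols, List.count_cons_self, Nat.add_eq_right] at h
        exact List.count_eq_zero.1 h
      have h3 := valenceList_of_notMem a args h2
      simp only [valence, if_true, h3, add_zero] at hv hj
      simp only [face, if_true]
      exact enc_expand a j args hv hj h2
    · rw [symbols, List.count_cons_of_ne h1] at h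
      simp only [valence, if_neg h1, zero_add] at hv hj
      simp only [face, if_neg h1, enc]
      rw [delOcc_cons_of_ne h1, encArgs_faceList i j a h1 args h hv hj]
  | cup a args r => by
    intro h hv hj
    by_cases h1 : a = i
    · subst h1
      simp only [symbols, List.count_cons_self, Nat.add_eq_right] at h
      have h2 := List.count_eq_zero.1 h
      simp only [List.mem_append, not_or] at h2
      have h3 := valenceList_of_notMem a args h2.1
      have h5 := valence_of_notMem a r h2.2
      simp only [valence, if_true, h3, h5, add_zero] at hv hj
      simp only [face, if_true]
      have h6 : enc (cup a args r) = enc (one a args) ++ r.enc := by simp [enc]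
      rw [enc_append, enc_expand a j args hv hj h2.1, h6, delOcc_append_of_lt]
      rw [count_enc]
      simp only [valence, if_true, h3, symbols, List.count_cons_self]
      omega
    · rw [symbols, List.count_cons_of_ne h1, List.count_append] at h
      simp only [valence, if_neg h1, zero_add] at hv hj
      simp only [face, if_neg h1, enc]
      rw [delOcc_cons_of_ne h1]
      rcases Nat.eq_zero_or_pos (List.count i (symbolsList args)) with h2 | h2
      · have h3 := List.count_eq_zero.1 h2
        have h4 := valenceList_of_notMem i args h3
        rw [faceList_of_notMem i j args h3,
          enc_face i j r (by omega) (by omega) (by omega),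
          delOcc_append_of_notMem]
        intro h
        rcases mem_encArgs h with h | h
        · exact h1 h.symm
        · exact h3 h
      · have h3 : i ∉ r.symbols := List.count_eq_zero.1 (by omega)
        have h4 := valence_of_notMem i r h3
        rw [face_of_notMem i j r h3,
          encArgs_faceList i j a h1 args (by omega) (by omega) (by omega), delOcc_append_of_lt]
        rw [← Nat.add_lt_add_iff_left (k := 0), zero_add]
        have h5 := count_enc i (one a args)
        simp only [enc, symbols, List.count_cons_of_ne h1, valence, if_neg h1] at h5
        omega
theorem encArgs_faceList (i : α) (j : ℕ) (a : α) (ha : a ≠ i) : ∀ l : List (Word α),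
    (symbolsList l).count i = 1 → 0 < valenceList i l → j ≤ valenceList i l →
    encArgs a (faceList i j l) = delOcc i j (encArgs a l)
  | [] => by simp [valenceList]
  | w :: ws => by
    intro h hv hj
    rw [symbolsList, List.count_append] at h
    simp only [valenceList] at hv hj
    simp only [faceList, encArgs]
    rcases Nat.eq_zero_or_pos (List.count i w.symbols) with h2 | h2
    · have h3 := List.count_eq_zero.1 h2
      have h4 := valence_of_notMem i w h3
      rw [face_of_notMem i j w h3, delOcc_append_of_notMem _ _ (by rwa [mem_enc]),
        delOcc_cons_of_ne ha, encArgs_faceList i j a ha ws (by omega) (by omega) (by omega)]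
    · have h3 : i ∉ symbolsList ws := List.count_eq_zero.1 (by omega)
      have h4 := valenceList_of_notMem i ws h3
      have h5 := count_enc i w
      rw [faceList_of_notMem i j ws h3, enc_face i j w (by omega) (by omega) (by omega),
        delOcc_append_of_lt]
      omega
end

end Word

/-! ### Normal forms of points -/

section Label

variable {α : Type} [DecidableEq α]

/-- Drop the first weight of the symbol `a`. -/
def shift (a : α) (c : α → ℕ → ℝ) (i : α) (m : ℕ) : ℝ := if i = a then c i (m + 1) else c i m

/-- Insert the weight `0` at the `j`-th place of the weights of `i`. -/
def insertZero (i : α) (j : ℕ) (c : α → ℕ → ℝ) (l : α) (m : ℕ) : ℝ :=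
  if l = i then (if m < j then c l m else if m = j then 0 else c l (m - 1)) else c l m

/-- Attach the weight `c i m` to the `m`-th occurrence of `i` in a sequence. -/
def label : List α → (α → ℕ → ℝ) → List (α × ℝ)
  | [], _ => []
  | a :: l, c => (a, c a 0) :: label l (shift a c)

/-- Attach weights to a sequence and remove the entries of weight `0`. -/
noncomputable def normalLabel (l : List α) (c : α → ℕ → ℝ) : List (α × ℝ) :=
  (label l c).filter fun x => x.2 ≠ 0

theorem map_fst_label : ∀ (l : List α) (c : α → ℕ → ℝ), (label l c).map Prod.fst = l
  | [], c => rfl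
  | a :: l, c => by simp [label, map_fst_label l]

theorem normalLabel_cons (a : α) (l : List α) (c : α → ℕ → ℝ) :
    normalLabel (a :: l) c =
      if c a 0 = 0 then normalLabel l (shift a c) else (a, c a 0) :: normalLabel l (shift a c) := by
  by_cases h : c a 0 = 0 <;> simp [normalLabel, label, h]

theorem map_fst_normalLabel_sublist (l : List α) (c : α → ℕ → ℝ) :
    ((normalLabel l c).map Prod.fst).Sublist l := by
  conv_rhs => rw [← map_fst_label l c]
  exact List.filter_sublist.map _

theorem shift_insertZero_zero (i : α) (c : α → ℕ → ℝ) : shift i (insertZero i 0 c) = c := by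
  funext l m
  by_cases h : l = i <;> simp [shift, insertZero, h]

theorem shift_insertZero_succ (i : α) (j : ℕ) (c : α → ℕ → ℝ) :
    shift i (insertZero i (j + 1) c) = insertZero i j (shift i c) := by
  funext l m
  by_cases h : l = i
  · subst h
    simp only [shift, insertZero, if_true]
    rcases lt_trichotomy m j with h | h | h
    · simp [h]
    · simp [h]
    · have h1 : m - 1 + 1 = m := by omega
      simp [h.not_gt, h.ne', h1]
  · simp [shift, insertZero, h]

theorem shift_insertZero_of_ne {a i : α} (h : a ≠ i) (j : ℕ) (c : α → ℕ → ℝ) :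
    shift a (insertZero i j c) = insertZero i j (shift a c) := by
  funext l m
  by_cases h1 : l = i
  · subst h1
    simp [shift, insertZero, h.symm]
  · simp [shift, insertZero, h1]

/-- Deleting an occurrence amounts to giving it the weight `0`. -/
theorem normalLabel_delOcc (i : α) : ∀ (j : ℕ) (l : List α) (c : α → ℕ → ℝ),
    normalLabel (Word.delOcc i j l) c = normalLabel l (insertZero i j c)
  | j, [], c => by simp [Word.delOcc, normalLabel, label]
  | j, a :: l, c => by
    by_cases h : a = i
    · subst h
      cases j with
      | zero =>
        rw [Word.delOcc_cons_self_zero, normalLabel_cons, shift_insertZero_zero]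
        simp [insertZero]
      | succ j =>
        rw [Word.delOcc_cons_self_succ, normalLabel_cons, normalLabel_cons,
          shift_insertZero_succ, normalLabel_delOcc a j l]
        simp [insertZero]
    · rw [Word.delOcc_cons_of_ne h, normalLabel_cons, normalLabel_cons,
        shift_insertZero_of_ne h, normalLabel_delOcc i j l]
      simp [insertZero, h]

theorem label_inj : ∀ {l : List α} {c d : α → ℕ → ℝ}, label l c = label l d →
    ∀ i m, m < l.count i → c i m = d i m
  | [], c, d, _, i, m, h => by simp at h
  | a :: l, c, d, h, i, m, hm => by
    simp only [label, List.cons.injEq, Prod.mk.injEq, true_and] at h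
    by_cases hi : i = a
    · subst hi
      cases m with
      | zero => exact h.1
      | succ m =>
        rw [List.count_cons_self] at hm
        simpa [shift] using label_inj h.2 i m (by omega)
    · rw [List.count_cons_of_ne (Ne.symm hi)] at hm
      simpa [shift, hi] using label_inj h.2 i m hm

theorem normalLabel_eq_label : ∀ {l : List α} {c : α → ℕ → ℝ},
    (∀ i m, m < l.count i → c i m ≠ 0) → normalLabel l c = label l c
  | [], c, _ => rfl
  | a :: l, c, h => by
    rw [normalLabel_cons, if_neg (h a 0 (by simp)), label, normalLabel_eq_label]
    intro i m hm
    by_cases hi : i = a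
    · subst hi
      simpa [shift] using h i (m + 1) (by simpa using hm)
    · simpa [shift, hi] using h i m (by simpa [List.count_cons_of_ne (Ne.symm hi)] using hm)

end Label

namespace Formula

variable {n : ℕ}

/-- The sequence of symbols of a formula. -/
def seq (f : Formula n) : List (Fin n) := f.word.enc

theorem nodup (f : Formula n) : f.word.symbols.Nodup :=
  List.nodup_iff_count_le_one.2 fun i => (f.once i).le

theorem isFormal (f : Formula n) : Word.IsFormal f.seq := Word.isFormal_enc f.nodup

theorem mem_seq (f : Formula n) (i : Fin n) : i ∈ f.seq :=
  Word.mem_enc.2 (List.count_pos_iff.1 (by rw [f.once]; exact one_pos))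

theorem count_seq (f : Formula n) (i : Fin n) : f.seq.count i = f.valence i + 1 :=
  Word.count_enc_pos_of_mem (f.once i)

theorem seq_injective : Function.Injective (seq : Formula n → List (Fin n)) := by
  intro f g h
  have := Word.enc_injective f.nodup g.nodup h
  cases f
  cases g
  simpa using this

theorem exists_seq {l : List (Fin n)} (h : Word.IsFormal l) (hl : ∀ i, i ∈ l) :
    ∃ f : Formula n, f.seq = l := by
  obtain ⟨w, hw, rfl⟩ := Word.exists_enc h
  exact ⟨⟨w, fun i => List.count_eq_one_of_mem hw (Word.mem_enc.1 (hl i))⟩, rfl⟩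

theorem seq_face (f : Formula n) (i : Fin n) (hi : 0 < f.valence i)
    (j : Fin (f.valence i + 1)) : (f.face i j).seq = Word.delOcc i j f.seq :=
  Word.enc_face i j f.word (f.once i) hi (Nat.lt_succ_iff.1 j.2)

/-- The barycentric coordinates of a point of a cell, extended by `0`. -/
noncomputable def coord (f : Formula n) (x : f.Cell) (i : Fin n) (m : ℕ) : ℝ :=
  if h : m < f.valence i + 1 then x i ⟨m, h⟩ else 0

theorem coord_of_lt (f : Formula n) (x : f.Cell) {i : Fin n} {m : ℕ} (h : m < f.valence i + 1) :
    f.coord x i m = x i ⟨m, h⟩ := dif_pos h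

theorem coord_of_ge (f : Formula n) (x : f.Cell) {i : Fin n} {m : ℕ} (h : f.valence i + 1 ≤ m) :
    f.coord x i m = 0 := dif_neg (by omega)

theorem coord_nonneg (f : Formula n) (x : f.Cell) (i : Fin n) (m : ℕ) : 0 ≤ f.coord x i m := by
  unfold coord
  split_ifs
  · exact (x i).2.1 _
  · exact le_rfl

theorem sum_coord (f : Formula n) (x : f.Cell) (i : Fin n) :
    ∑ m ∈ Finset.range (f.valence i + 1), f.coord x i m = 1 := by
  rw [Finset.sum_range]
  simp only [coord, Fin.is_lt, dif_pos]
  exact (x i).2.2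

theorem cell_ext {f : Formula n} {x y : f.Cell}
    (h : ∀ i m, m < f.valence i + 1 → f.coord x i m = f.coord y i m) : x = y := by
  funext i
  ext m
  have := h i m m.2
  rwa [coord_of_lt f x m.2, coord_of_lt f y m.2] at this

theorem continuous_coord (f : Formula n) (i : Fin n) (m : ℕ) :
    Continuous fun x : f.Cell => f.coord x i m := by
  unfold coord
  split_ifs with h
  · exact (continuous_apply (⟨m, h⟩ : Fin (f.valence i + 1))).comp
      (continuous_subtype_val.comp (continuous_apply i))
  · exact continuous_const

/-- The point of a cell with given barycentric coordinates. -/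
def ofCoord (f : Formula n) (c : Fin n → ℕ → ℝ) (h0 : ∀ i m, 0 ≤ c i m)
    (h1 : ∀ i, ∑ m ∈ Finset.range (f.valence i + 1), c i m = 1) : f.Cell :=
  fun i => ⟨fun m => c i m, fun m => h0 i m, by rw [← h1 i, Finset.sum_range]⟩

theorem coord_ofCoord (f : Formula n) (c : Fin n → ℕ → ℝ) (h0 : ∀ i m, 0 ≤ c i m)
    (h1 : ∀ i, ∑ m ∈ Finset.range (f.valence i + 1), c i m = 1) (i : Fin n) (m : ℕ)
    (hm : m < f.valence i + 1) : f.coord (f.ofCoord c h0 h1) i m = c i m := by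
  rw [coord_of_lt _ _ hm]
  rfl

theorem continuous_ofCoord {Z : Type*} [TopologicalSpace Z] (f : Formula n)
    (c : Z → Fin n → ℕ → ℝ) (h0 : ∀ z i m, 0 ≤ c z i m)
    (h1 : ∀ z i, ∑ m ∈ Finset.range (f.valence i + 1), c z i m = 1)
    (hc : ∀ i m, Continuous fun z => c z i m) :
    Continuous fun z => f.ofCoord (c z) (h0 z) (h1 z) :=
  continuous_pi fun i => Continuous.subtype_mk
    (continuous_pi fun m : Fin (f.valence i + 1) => hc i m) _

theorem stdSimplex_map_apply {M N : ℕ} (φ : Fin M → Fin N) (hφ : Function.Injective φ)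
    (x : stdSimplex ℝ (Fin M)) (k : Fin M) : stdSimplex.map φ x (φ k) = x k := by
  rw [stdSimplex.map_coe, FunOnFinite.linearMap_apply_apply, Finset.sum_eq_single k]
  · intro b hb hbk
    exact (hbk (hφ (Finset.mem_filter.1 hb).2)).elim
  · intro h
    simp at h

theorem stdSimplex_map_apply_of_notMem {M N : ℕ} (φ : Fin M → Fin N)
    (x : stdSimplex ℝ (Fin M)) (m : Fin N) (hm : ∀ k, φ k ≠ m) : stdSimplex.map φ x m = 0 := by
  rw [stdSimplex.map_coe, FunOnFinite.linearMap_apply_apply]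
  exact Finset.sum_eq_zero fun b hb => (hm b (Finset.mem_filter.1 hb).2).elim

theorem faceVertex_injective (f : Formula n) (i : Fin n) (hi : 0 < f.valence i)
    (j : Fin (f.valence i + 1)) (l : Fin n) : Function.Injective (f.faceVertex i hi j l) := by
  intro a b h
  simp only [faceVertex, Fin.mk.injEq] at h
  ext
  split_ifs at h <;> omega

theorem coord_faceMap (f : Formula n) (i : Fin n) (hi : 0 < f.valence i)
    (j : Fin (f.valence i + 1)) (x : (f.face i j).Cell) :
    f.coord (f.faceMap i hi j x) = insertZero i j ((f.face i j).coord x) := by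
  funext l m
  have hv := f.valence_face i l hi j
  have hj := j.2
  have key : ∀ k (hk : k < (f.face i j).valence l + 1) (hm : m < f.valence l + 1),
      (if l = i ∧ (j : ℕ) ≤ k then k + 1 else k) = m →
      f.coord (f.faceMap i hi j x) l m = (f.face i j).coord x l k := by
    intro k hk hm h
    have : f.faceVertex i hi j l ⟨k, hk⟩ = ⟨m, hm⟩ := Fin.ext h
    rw [coord_of_lt _ _ hm, coord_of_lt _ _ hk, ← this]
    exact stdSimplex_map_apply _ (f.faceVertex_injective i hi j l) _ _
  unfold insertZero
  by_cases h : l = i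
  · subst h
    simp only [if_true] at hv ⊢
    rcases lt_trichotomy m j with h | h | h
    · rw [if_pos h]
      exact key m (by omega) (by omega) (by simp [h])
    · rw [if_neg h.not_lt, if_pos h, coord_of_lt _ _ (show m < f.valence l + 1 by omega)]
      refine stdSimplex_map_apply_of_notMem _ _ _ fun k hk => ?_
      simp only [faceVertex, Fin.mk.injEq, true_and] at hk
      split_ifs at hk <;> omega
    · rw [if_neg h.not_gt, if_neg h.ne']
      by_cases hm : m < f.valence l + 1
      · exact key (m - 1) (by omega) hm (by rw [if_pos ⟨rfl, by omega⟩]; omega)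
      · rw [coord_of_ge _ _ (by omega), coord_of_ge _ _ (by omega)]
  · simp only [if_neg h, add_zero] at hv ⊢
    by_cases hm : m < f.valence l + 1
    · exact key m (by omega) hm (by simp [h])
    · rw [coord_of_ge _ _ (by omega), coord_of_ge _ _ (by omega)]

theorem continuous_faceMap (f : Formula n) (i : Fin n) (hi : 0 < f.valence i)
    (j : Fin (f.valence i + 1)) : Continuous (f.faceMap i hi j) :=
  continuous_pi fun l => (stdSimplex.continuous_map _).comp (continuous_apply l)

/-- A point with a vanishing coordinate lies in a face. -/
theorem exists_faceMap_eq (f : Formula n) (x : f.Cell) (i : Fin n) (m : ℕ)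
    (hm : m < f.valence i + 1) (h : f.coord x i m = 0) :
    ∃ (hi : 0 < f.valence i) (j : Fin (f.valence i + 1)) (y : (f.face i j).Cell),
      f.faceMap i hi j y = x := by
  have hi : 0 < f.valence i := by
    by_contra h0
    have h1 := f.sum_coord x i
    have h0 : f.valence i = 0 := by omega
    have hm : m = 0 := by omega
    subst hm
    rw [h0] at h1
    simp [h] at h1
  refine ⟨hi, ⟨m, hm⟩, ?_⟩
  have hv := fun l => f.valence_face i l hi ⟨m, hm⟩
  set c : Fin n → ℕ → ℝ := fun l k =>
    if l = i ∧ m ≤ k then f.coord x l (k + 1) else f.coord x l k with hc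
  have hsum : ∀ l, ∑ k ∈ Finset.range ((f.face i m).valence l + 1), c l k = 1 := by
    intro l
    have hv := hv l
    rw [← f.sum_coord x l]
    by_cases hl : l = i
    · subst hl
      simp only [if_true] at hv
      have e1 : (f.face l m).valence l + 1 = m + ((f.face l m).valence l + 1 - m) := by
        omega
      have e2 : f.valence l + 1 = (m + 1) + ((f.face l m).valence l + 1 - m) := by
        omega
      rw [e2, e1, Finset.sum_range_add, Finset.sum_range_add, Finset.sum_range_succ, h, add_zero]
      congr 1
      · refine Finset.sum_congr rfl fun k hk => ?_
        have : ¬ m ≤ k := by simpa using hk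
        simp [hc, this]
      · rw [Nat.add_sub_cancel_left]
        refine Finset.sum_congr rfl fun k hk => ?_
        simp only [hc, le_add_iff_nonneg_right, zero_le, and_self, if_true]
        congr 1
        omega
    · simp only [if_neg hl, add_zero] at hv
      rw [hv]
      exact Finset.sum_congr rfl fun k _ => by simp [hc, hl]
  refine ⟨(f.face i m).ofCoord c (fun l k => ?_) hsum, ?_⟩
  · simp only [hc]
    split_ifs <;> exact f.coord_nonneg x _ _
  · apply cell_ext
    intro l k hk
    have hv := hv l
    rw [coord_faceMap]
    unfold insertZero
    by_cases hl : l = i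
    · subst hl
      simp only [if_true] at hv ⊢
      rcases lt_trichotomy k m with h' | h' | h'
      · rw [if_pos h']
        refine (coord_ofCoord _ _ _ _ _ _ ?_).trans ?_
        · omega
        · simp [hc, h']
      · rw [if_neg h'.not_lt, if_pos h', h', h]
      · rw [if_neg h'.not_gt, if_neg h'.ne']
        refine (coord_ofCoord _ _ _ _ _ _ ?_).trans ?_
        · omega
        · have h2 : m ≤ k - 1 := by omega
          have h3 : k - 1 + 1 = k := by omega
          simp [hc, h2, h3]
    · simp only [if_neg hl, add_zero] at hv ⊢
      refine (coord_ofCoord _ _ _ _ _ _ ?_).trans ?_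
      · omega
      · simp [hc, hl]

/-- A point in the interior of a cell: no barycentric coordinate vanishes. -/
def IsInterior (f : Formula n) (x : f.Cell) : Prop :=
  ∀ i m, m < f.valence i + 1 → f.coord x i m ≠ 0

/-- The sequence of a formula, labelled by the coordinates of a point, without the entries of
weight `0`. -/
noncomputable def normalForm (f : Formula n) (x : f.Cell) : List (Fin n × ℝ) :=
  normalLabel f.seq (f.coord x)

theorem normalForm_faceMap (f : Formula n) (i : Fin n) (hi : 0 < f.valence i)
    (j : Fin (f.valence i + 1)) (x : (f.face i j).Cell) :
    f.normalForm (f.faceMap i hi j x) = (f.face i j).normalForm x := by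
  unfold normalForm
  rw [coord_faceMap, seq_face f i hi j, normalLabel_delOcc]

theorem normalForm_eq_of_isInterior {f : Formula n} {x : f.Cell} (h : f.IsInterior x) :
    f.normalForm x = label f.seq (f.coord x) :=
  normalLabel_eq_label fun i m hm => h i m (by rwa [count_seq] at hm)

theorem map_fst_normalForm_of_isInterior {f : Formula n} {x : f.Cell} (h : f.IsInterior x) :
    (f.normalForm x).map Prod.fst = f.seq := by
  rw [normalForm_eq_of_isInterior h, map_fst_label]

theorem sum_valence_face (f : Formula n) (i : Fin n) (hi : 0 < f.valence i)
    (j : Fin (f.valence i + 1)) : ∑ l, f.valence l = ∑ l, (f.face i j).valence l + 1 := by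
  rw [Finset.sum_congr rfl fun l _ => f.valence_face i l hi j, Finset.sum_add_distrib]
  simp

end Formula

namespace Complex

variable {n : ℕ}

/-- The point of the cell complex given by a point of a cell. -/
def mk (f : Formula n) (x : f.Cell) : Complex n := Quot.mk (Glue n) ⟨f, x⟩

theorem mk_faceMap (f : Formula n) (i : Fin n) (hi : 0 < f.valence i)
    (j : Fin (f.valence i + 1)) (x : (f.face i j).Cell) :
    mk f (f.faceMap i hi j x) = mk (f.face i j) x :=
  (Quot.sound (Glue.face f i hi j x)).symm

theorem continuous_mk (f : Formula n) : Continuous (mk f) :=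
  continuous_quot_mk.comp continuous_sigmaMk

theorem exists_mk (y : Complex n) : ∃ f x, y = mk f x := by
  induction y using Quot.ind with
  | mk p => exact ⟨p.1, p.2, rfl⟩

theorem exists_interior_aux : ∀ (k : ℕ) (f : Formula n) (x : f.Cell), ∑ l, f.valence l ≤ k →
    ∃ (g : Formula n) (y : g.Cell), g.IsInterior y ∧ mk f x = mk g y := by
  intro k
  induction k with
  | zero =>
    intro f x hk
    refine ⟨f, x, fun i m hm h => ?_, rfl⟩
    obtain ⟨hi, -⟩ := f.exists_faceMap_eq x i m hm h
    have := Finset.single_le_sum (f := fun l => f.valence l) (fun l _ => Nat.zero_le _)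
      (Finset.mem_univ i)
    omega
  | succ k ih =>
    intro f x hk
    by_cases h : f.IsInterior x
    · exact ⟨f, x, h, rfl⟩
    · unfold Formula.IsInterior at h
      push Not at h
      obtain ⟨i, m, hm, h⟩ := h
      obtain ⟨hi, j, y, rfl⟩ := f.exists_faceMap_eq x i m hm h
      have := f.sum_valence_face i hi j
      rw [mk_faceMap]
      exact ih _ _ (by omega)

/-- Every point lies in the interior of some cell. -/
theorem exists_interior (y : Complex n) :
    ∃ (f : Formula n) (x : f.Cell), f.IsInterior x ∧ y = mk f x := by
  obtain ⟨f, x, rfl⟩ := y.exists_mk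
  exact exists_interior_aux _ f x le_rfl

/-- The normal form of a point of the cell complex: the sequence of the cell that contains the
point in its interior, labelled by the coordinates of the point. -/
noncomputable def normalForm : Complex n → List (Fin n × ℝ) :=
  Quot.lift (fun p => p.1.normalForm p.2) (by
    rintro _ _ ⟨f, i, hi, j, x⟩
    exact (f.normalForm_faceMap i hi j x).symm)

theorem normalForm_mk (f : Formula n) (x : f.Cell) : (mk f x).normalForm = f.normalForm x := rfl

/-- Distinct points of the cell complex have distinct normal forms. -/
theorem normalForm_injective : Function.Injective (normalForm : Complex n → _) := by
  intro y z h
  obtain ⟨f, x, hx, rfl⟩ := y.exists_interior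
  obtain ⟨g, x', hx', rfl⟩ := z.exists_interior
  rw [normalForm_mk, normalForm_mk] at h
  have h1 : f = g := by
    apply Formula.seq_injective
    rw [← Formula.map_fst_normalForm_of_isInterior hx, h,
      Formula.map_fst_normalForm_of_isInterior hx']
  subst h1
  rw [Formula.normalForm_eq_of_isInterior hx, Formula.normalForm_eq_of_isInterior hx'] at h
  congr 1
  refine Formula.cell_ext fun i m hm => label_inj h i m ?_
  rwa [f.count_seq]

end Complex

/-! ### Colimits of subspaces -/

/-- If every point `x` lies in a smallest member `I (sel x)` of a family of subspaces, and the
continuity of maps can be tested on the members, then the space is the colimit of the family. -/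
theorem isColimit_subspaceCocone {P : Type} [PartialOrder P] {X : Type} [TopologicalSpace X]
    (I : P →o Set X) (sel : X → P) (hsel : ∀ x, x ∈ I (sel x))
    (hmin : ∀ x a, x ∈ I a → sel x ≤ a)
    (hcont : ∀ (Z : Type) [TopologicalSpace Z] (g : X → Z),
      (∀ a, Continuous fun x : I a => g x) → Continuous g) :
    Nonempty (IsColimit (subspaceCocone I)) := by
  have key : ∀ (s : Cocone (subspaceFunctor I)) (a : P) (x : X) (hx : x ∈ I a),
      (s.ι.app (sel x)).hom (⟨x, hsel x⟩ : I (sel x)) = (s.ι.app a).hom (⟨x, hx⟩ : I a) := by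
    intro s a x hx
    have h := s.w (homOfLE (hmin x a hx))
    rw [← h]
    rfl
  refine ⟨{
    desc := fun s => TopCat.ofHom ⟨fun x => (s.ι.app (sel x)).hom (⟨x, hsel x⟩ : I (sel x)),
      hcont _ _ fun a => ?_⟩
    fac := fun s a => ?_
    uniq := fun s m hm => ?_ }⟩
  · have : (fun x : I a => (s.ι.app (sel x)).hom (⟨x, hsel x⟩ : I (sel x))) =
        fun x : I a => (s.ι.app a).hom x := funext fun x => key s a x x.2
    rw [this]
    exact (s.ι.app a).hom.continuous
  · ext x
    exact key s a x.1 x.2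
  · ext x
    have h := hm (sel x)
    exact congrArg (fun k => k.hom (⟨x, hsel x⟩ : I (sel x))) h

/-! ### The order pair of a formula -/

theorem cons_sublist_iff_getElem {α : Type} {i : α} {s : List α} : ∀ {l : List α},
    (i :: s).Sublist l ↔ ∃ a, l[a]? = some i ∧ s.Sublist (l.drop (a + 1))
  | [] => by simp
  | b :: l => by
    rw [List.sublist_cons_iff]
    constructor
    · rintro (h | ⟨r, h, h'⟩)
      · obtain ⟨a, h1, h2⟩ := cons_sublist_iff_getElem.1 h
        exact ⟨a + 1, by simpa using h1, by simpa using h2⟩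
      · simp only [List.cons.injEq] at h
        exact ⟨0, by simp [h.1], by simpa [h.2] using h'⟩
    · rintro ⟨_ | a, h1, h2⟩
      · simp only [List.getElem?_cons_zero, Option.some.injEq] at h1
        exact Or.inr ⟨s, by rw [h1], by simpa using h2⟩
      · exact Or.inl (cons_sublist_iff_getElem.2 ⟨a, by simpa using h1, by simpa using h2⟩)

theorem pair_sublist_iff {α : Type} {i j : α} {l : List α} : [i, j].Sublist l ↔
    ∃ a b : ℕ, a < b ∧ l[a]? = some i ∧ l[b]? = some j := by
  simp only [cons_sublist_iff_getElem, List.getElem?_drop, List.nil_sublist, and_true]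
  constructor
  · rintro ⟨a, h1, b, h2⟩
    exact ⟨a, _, by omega, h1, h2⟩
  · rintro ⟨a, b, hab, h1, h2⟩
    exact ⟨a, h1, b - (a + 1), by rwa [Nat.add_sub_cancel' (by omega)]⟩

theorem triple_sublist_iff {α : Type} {i j k : α} {l : List α} : [i, j, k].Sublist l ↔
    ∃ a b c : ℕ, a < b ∧ b < c ∧ l[a]? = some i ∧ l[b]? = some j ∧ l[c]? = some k := by
  rw [cons_sublist_iff_getElem]
  simp only [pair_sublist_iff, List.getElem?_drop]
  constructor
  · rintro ⟨a, h1, b, c, hbc, h2, h3⟩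
    exact ⟨a, _, _, by omega, by omega, h1, h2, h3⟩
  · rintro ⟨a, b, c, hab, hbc, h1, h2, h3⟩
    exact ⟨a, h1, b - (a + 1), c - (a + 1), by omega, by rwa [Nat.add_sub_cancel' (by omega)],
      by rwa [Nat.add_sub_cancel' (by omega)]⟩

theorem four_sublist_of_getElem {α : Type} {i j k m : α} {l : List α} {a b c d : ℕ}
    (hab : a < b) (hbc : b < c) (hcd : c < d) (h1 : l[a]? = some i) (h2 : l[b]? = some j)
    (h3 : l[c]? = some k) (h4 : l[d]? = some m) : [i, j, k, m].Sublist l := by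
  rw [cons_sublist_iff_getElem]
  refine ⟨a, h1, triple_sublist_iff.2 ⟨b - (a + 1), c - (a + 1), d - (a + 1), by omega,
    by omega, ?_, ?_, ?_⟩⟩ <;> rwa [List.getElem?_drop, Nat.add_sub_cancel' (by omega)]

theorem idxOf_le_of_getElem {α : Type} [DecidableEq α] {i : α} : ∀ {l : List α} {a : ℕ},
    l[a]? = some i → l.idxOf i ≤ a
  | [], a, h => by simp at h
  | b :: l, 0, h => by simp at h; simp [h]
  | b :: l, a + 1, h => by
    rw [List.idxOf_cons]
    have := idxOf_le_of_getElem (l := l) (a := a) (by simpa using h)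
    cases (b == i)
    · simp only [cond_false]; omega
    · simp

namespace Formula

variable {n : ℕ}

/-- The order pair of a formula: `t` orders the symbols by their first occurrence (that is, as
they are written in the formula), and `p i j` says that `j` occurs inside `i(x₁, …, x_k)`. -/
def orderPair (f : Formula n) : OrderPair n where
  t i j := f.seq.idxOf i < f.seq.idxOf j
  p i j := i ≠ j ∧ [i, j, i].Sublist f.seq
  total :=
    { irrefl := fun i => lt_irrefl _
      trans := fun i j k h h' => lt_trans h h'
      trichotomous := fun i j h h' => by
        exact (List.idxOf_inj (f.mem_seq i)).1 (by omega) }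
  partialOrd :=
    { irrefl := fun i h => h.1 rfl
      trans := fun i j k h h' => by
        obtain ⟨hij, h⟩ := h
        obtain ⟨hjk, h'⟩ := h'
        obtain ⟨a₁, a₂, a₃, ha, ha', e₁, e₂, e₃⟩ := triple_sublist_iff.1 h
        obtain ⟨b₁, b₂, b₃, hb, hb', g₁, g₂, g₃⟩ := triple_sublist_iff.1 h'
        have h1 : a₁ < b₁ := by
          by_contra h
          have : a₁ ≠ b₁ := by rintro rfl; rw [e₁] at g₁; exact hij (Option.some.inj g₁)
          exact f.isFormal.noncrossing j i hij.symm
            (four_sublist_of_getElem (by omega) ha ha' g₁ e₁ e₂ e₃)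
        have h3 : b₃ < a₃ := by
          by_contra h
          have : a₃ ≠ b₃ := by rintro rfl; rw [e₃] at g₃; exact hij (Option.some.inj g₃)
          exact f.isFormal.noncrossing i j hij
            (four_sublist_of_getElem ha ha' (by omega) e₁ e₂ e₃ g₃)
        refine ⟨?_, triple_sublist_iff.2 ⟨a₁, b₂, a₃, by omega, by omega, e₁, g₂, e₃⟩⟩
        rintro rfl
        exact f.isFormal.noncrossing i j hij
          (four_sublist_of_getElem h1 hb hb' e₁ g₁ g₂ g₃) }
  sub i j h := by
    obtain ⟨hij, h⟩ := h
    obtain ⟨a₁, a₂, a₃, ha, ha', e₁, e₂, e₃⟩ := triple_sublist_iff.1 h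
    by_contra hlt
    have h1 := List.getElem?_idxOf (f.mem_seq j)
    have h2 := idxOf_le_of_getElem e₁
    have : f.seq.idxOf j ≠ a₁ := by
      intro h; rw [h, e₁] at h1; exact hij (Option.some.inj h1)
    exact f.isFormal.noncrossing j i hij.symm
      (four_sublist_of_getElem (by omega) ha ha' h1 e₁ e₂ e₃)
  consistent i j k h h' hp := by
    obtain ⟨a₁, a₂, a₃, ha, ha', e₁, e₂, e₃⟩ := triple_sublist_iff.1 hp.2
    have h2 := idxOf_le_of_getElem e₂
    exact ⟨by rintro rfl; exact lt_irrefl _ h, triple_sublist_iff.2 ⟨_, _, _, h, by omega,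
      List.getElem?_idxOf (f.mem_seq i), List.getElem?_idxOf (f.mem_seq j), e₃⟩⟩

end Formula

/-! ### The subcomplex of an order pair -/

namespace OrderPair

variable {n : ℕ}

theorem t_irrefl (a : OrderPair n) (i : Fin n) : ¬ a.t i i := by
  have := a.total
  exact irrefl (r := a.t) i

theorem t_asymm (a : OrderPair n) {i j : Fin n} (h : a.t i j) : ¬ a.t j i := fun h' =>
  a.t_irrefl i (a.total.trans _ _ _ h h')

theorem t_total (a : OrderPair n) {i j : Fin n} (h : i ≠ j) : a.t i j ∨ a.t j i := by
  have := a.total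
  rcases trichotomous_of a.t i j with h' | h' | h'
  · exact Or.inl h'
  · exact (h h').elim
  · exact Or.inr h'

/-- The condition on the sequence of a formula `f` that the order pair of `f` is at most `a`: only
nestings from `p` occur, and `i` can be to the left of `j` only if `i < j` in `t`, unless `j < i`
in `p`. It is inherited by subsequences, hence by faces. -/
def Compatible (a : OrderPair n) (l : List (Fin n)) : Prop :=
  ∀ i j, i ≠ j → ([i, j, i].Sublist l → a.p i j) ∧ ([i, j].Sublist l → a.t i j ∨ a.p j i)

theorem Compatible.sublist {a : OrderPair n} {l r : List (Fin n)} (h : a.Compatible l)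
    (hr : r.Sublist l) : a.Compatible r := fun i j hij =>
  ⟨fun h' => (h i j hij).1 (h'.trans hr), fun h' => (h i j hij).2 (h'.trans hr)⟩

theorem Compatible.mono {a b : OrderPair n} (hab : a ≤ b) {l : List (Fin n)}
    (h : a.Compatible l) : b.Compatible l := by
  intro i j hij
  refine ⟨fun h' => hab.1 _ _ ((h i j hij).1 h'), fun h' => ?_⟩
  rcases (h i j hij).2 h' with h1 | h1
  · rcases b.t_total hij with h2 | h2
    · exact Or.inl h2
    · exact Or.inr (hab.2 _ _ h2 h1)
  · exact Or.inr (hab.1 _ _ h1)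

theorem compatible_orderPair (f : Formula n) : f.orderPair.Compatible f.seq := by
  intro i j hij
  refine ⟨fun h => ⟨hij, h⟩, fun h => ?_⟩
  obtain ⟨a, b, hab, e₁, e₂⟩ := pair_sublist_iff.1 h
  rcases f.orderPair.t_total hij with h1 | h1
  · exact Or.inl h1
  · have := idxOf_le_of_getElem e₁
    exact Or.inr ⟨hij.symm, triple_sublist_iff.2 ⟨_, a, b, lt_of_lt_of_le h1 this, hab,
      List.getElem?_idxOf (f.mem_seq j), e₁, e₂⟩⟩

theorem orderPair_le {a : OrderPair n} {f : Formula n} (h : a.Compatible f.seq) :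
    f.orderPair ≤ a := by
  refine ⟨fun i j hp => (h i j hp.1).1 hp.2, fun i j ht hf => ?_⟩
  have hij : j ≠ i := by rintro rfl; exact a.t_irrefl _ ht
  exact ((h j i hij).2 (pair_sublist_iff.2 ⟨_, _, hf, List.getElem?_idxOf (f.mem_seq j),
    List.getElem?_idxOf (f.mem_seq i)⟩)).resolve_left (a.t_asymm ht)

/-- The union of the closed cells of the formulas whose order pair is at most `a`. -/
def subcomplex : OrderPair n →o Set (Complex n) where
  toFun a := ⋃ f ∈ {f : Formula n | a.Compatible f.seq}, closedCell f
  monotone' _ _ hab := Set.biUnion_subset_biUnion_left fun _ hf => hf.mono hab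

theorem mem_subcomplex {a : OrderPair n} {y : Complex n} :
    y ∈ subcomplex a ↔ ∃ f x, a.Compatible f.seq ∧ y = Complex.mk f x := by
  simp only [subcomplex, OrderHom.coe_mk, Set.mem_iUnion, Set.mem_ofPred_eq, exists_prop,
    closedCell, Complex.mk]
  constructor
  · rintro ⟨f, h, x, rfl⟩
    exact ⟨f, x, h, rfl⟩
  · rintro ⟨f, x, h, rfl⟩
    exact ⟨f, h, x, rfl⟩

theorem mk_mem_subcomplex {a : OrderPair n} {f : Formula n} (h : a.Compatible f.seq)
    (x : f.Cell) : Complex.mk f x ∈ subcomplex a := mem_subcomplex.2 ⟨f, x, h, rfl⟩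

/-- A subcomplex that meets the interior of a cell contains the cell. -/
theorem compatible_of_mem {a : OrderPair n} {f : Formula n} {x : f.Cell} (hx : f.IsInterior x)
    (h : Complex.mk f x ∈ subcomplex a) : a.Compatible f.seq := by
  obtain ⟨g, y, hg, hy⟩ := mem_subcomplex.1 h
  have := congrArg Complex.normalForm hy
  rw [Complex.normalForm_mk, Complex.normalForm_mk] at this
  rw [← Formula.map_fst_normalForm_of_isInterior hx, this]
  exact hg.sublist (map_fst_normalLabel_sublist _ _)

theorem isClosed_preimage_aux {a : OrderPair n} {K : Set (Complex n)} (hK : K ⊆ subcomplex a)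
    (h : ∀ f : Formula n, a.Compatible f.seq → IsClosed (Complex.mk f ⁻¹' K)) :
    ∀ (k : ℕ) (f : Formula n), ∑ l, f.valence l ≤ k → IsClosed (Complex.mk f ⁻¹' K) := by
  intro k
  induction k with
  | zero =>
    intro f hk
    by_cases hf : a.Compatible f.seq
    · exact h f hf
    · convert isClosed_empty
      rw [Set.eq_empty_iff_forall_notMem]
      intro x hx
      refine hf (compatible_of_mem (fun i m hm h0 => ?_) (hK hx))
      obtain ⟨hi, -⟩ := f.exists_faceMap_eq x i m hm h0
      have := Finset.single_le_sum (f := fun l => f.valence l) (fun l _ => Nat.zero_le _)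
        (Finset.mem_univ i)
      omega
  | succ k ih =>
    intro f hk
    by_cases hf : a.Compatible f.seq
    · exact h f hf
    -- A point of `K` in a cell outside of the subcomplex lies in a face of that cell.
    · have : Complex.mk f ⁻¹' K = ⋃ (i : Fin n), ⋃ (hi : 0 < f.valence i),
          ⋃ (j : Fin (f.valence i + 1)),
            f.faceMap i hi j '' (Complex.mk (f.face i j) ⁻¹' K) := by
        ext x
        simp only [Set.mem_iUnion, Set.mem_image, Set.mem_preimage]
        constructor
        · intro hx
          by_cases h1 : f.IsInterior x
          · exact (hf (compatible_of_mem h1 (hK hx))).elim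
          · unfold Formula.IsInterior at h1
            push Not at h1
            obtain ⟨i, m, hm, h1⟩ := h1
            obtain ⟨hi, j, y, rfl⟩ := f.exists_faceMap_eq x i m hm h1
            exact ⟨i, hi, j, y, by rwa [Complex.mk_faceMap] at hx, rfl⟩
        · rintro ⟨i, hi, j, y, hy, rfl⟩
          rwa [Complex.mk_faceMap]
      rw [this]
      refine isClosed_iUnion_of_finite fun i => isClosed_iUnion_of_finite fun hi =>
        isClosed_iUnion_of_finite fun j => ?_
      have := f.sum_valence_face i hi j
      exact ((ih (f.face i j) (by omega)).isCompact.image (f.continuous_faceMap i hi j)).isClosed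

/-- The subspace topology of a subcomplex is the weak topology with respect to its cells: a map is
continuous if it is continuous on the cells. The preimage of a closed set in another cell is a
finite union of images of compact sets in the faces. -/
theorem continuous_of_cells {a : OrderPair n} {Z : Type*} [TopologicalSpace Z]
    (Φ : subcomplex a → Z)
    (h : ∀ (f : Formula n) (hf : a.Compatible f.seq),
      Continuous fun x : f.Cell => Φ ⟨Complex.mk f x, mk_mem_subcomplex hf x⟩) :
    Continuous Φ := by
  rw [continuous_iff_isClosed]
  intro T hT
  have hcl : IsClosed (Subtype.val '' (Φ ⁻¹' T) : Set (Complex n)) := by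
    have : ∀ f : Formula n, IsClosed (Complex.mk f ⁻¹' (Subtype.val '' (Φ ⁻¹' T))) := by
      intro f
      refine isClosed_preimage_aux (a := a) (by rintro _ ⟨y, -, rfl⟩; exact y.2) ?_ _ f le_rfl
      intro f hf
      convert hT.preimage (h f hf) using 1
      ext x
      simp [mk_mem_subcomplex hf x]
    refine isClosed_coinduced.2 (isClosed_sigma_iff.2 fun f => this f)
  convert hcl.preimage continuous_subtype_val
  rw [Set.preimage_image_eq _ Subtype.val_injective]

theorem isSubcomplex_subcomplex (a : OrderPair n) : IsSubcomplex (subcomplex a) :=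
  ⟨{f | a.Compatible f.seq}, rfl⟩

theorem mk_mem_subcomplex_orderPair (f : Formula n) (x : f.Cell) :
    Complex.mk f x ∈ subcomplex f.orderPair := mk_mem_subcomplex (compatible_orderPair f) x

theorem iUnion_subcomplex : (⋃ a : OrderPair n, subcomplex a) = Set.univ := by
  rw [Set.eq_univ_iff_forall]
  intro y
  obtain ⟨f, x, rfl⟩ := y.exists_mk
  exact Set.mem_iUnion.2 ⟨_, mk_mem_subcomplex_orderPair f x⟩

/-- The smallest subcomplex containing a point belongs to the order pair of the formula whose cell
contains the point in its interior. -/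
theorem isColimit_subcomplex :
    Nonempty (IsColimit (subspaceCocone (subcomplex : OrderPair n →o Set (Complex n)))) := by
  choose F X hX hF using fun y : Complex n => y.exists_interior
  refine isColimit_subspaceCocone _ (fun y => (F y).orderPair) (fun y => ?_) (fun y a h => ?_)
    fun Z _ g hg => ?_
  · have := mk_mem_subcomplex_orderPair (F y) (X y)
    rwa [← hF y] at this
  · rw [hF y] at h
    exact orderPair_le (compatible_of_mem (hX y) h)
  · refine continuous_coinduced_dom.2 (continuous_sigma fun f => ?_)
    exact (hg f.orderPair).comp (Continuous.subtype_mk (Complex.continuous_mk f)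
      (mk_mem_subcomplex_orderPair f))

end OrderPair

/-! ### Removing a symbol from a labelled sequence -/

section Label

variable {α : Type} [DecidableEq α]

theorem normalLabel_congr : ∀ {l : List α} {c d : α → ℕ → ℝ},
    (∀ i k, k < l.count i → c i k = d i k) → normalLabel l c = normalLabel l d
  | [], c, d, _ => rfl
  | a :: l, c, d, h => by
    have h0 : c a 0 = d a 0 := h a 0 (by simp)
    have h1 : normalLabel l (shift a c) = normalLabel l (shift a d) := by
      refine normalLabel_congr fun i k hk => ?_
      by_cases hi : i = a
      · subst hi
        simpa [shift] using h i (k + 1) (by simpa using hk)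
      · simpa [shift, hi] using h i k (by simpa [List.count_cons_of_ne (Ne.symm hi)] using hk)
    rw [normalLabel_cons, normalLabel_cons, h0, h1]

theorem normalLabel_map {β : Type} [DecidableEq β] {σ : β → α} (hσ : Function.Injective σ) :
    ∀ (l : List β) {c : α → ℕ → ℝ} {d : β → ℕ → ℝ}, (∀ i k, c (σ i) k = d i k) →
      normalLabel (l.map σ) c = (normalLabel l d).map (Prod.map σ id)
  | [], c, d, _ => rfl
  | a :: l, c, d, h => by
    have ih : normalLabel (l.map σ) (shift (σ a) c) =
        (normalLabel l (shift a d)).map (Prod.map σ id) := by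
      refine normalLabel_map hσ l fun i k => ?_
      by_cases hi : i = a
      · subst hi
        simp [shift, h]
      · have : σ i ≠ σ a := fun h => hi (hσ h)
        simp [shift, hi, this, h]
    rw [List.map_cons, normalLabel_cons, normalLabel_cons, h, ih]
    split_ifs <;> simp

theorem normalLabel_filter (m : α) : ∀ (l : List α) (c : α → ℕ → ℝ),
    normalLabel (l.filter (· ≠ m)) c = (normalLabel l c).filter (·.1 ≠ m)
  | [], c => rfl
  | a :: l, c => by
    by_cases h : a = m
    · subst h
      have h1 : normalLabel (l.filter (· ≠ a)) c =
          normalLabel (l.filter (· ≠ a)) (shift a c) := by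
        refine normalLabel_congr fun i k hk => ?_
        have : i ≠ a := by
          rintro rfl
          simp [List.count_eq_zero.2] at hk
        simp [shift, this]
      rw [List.filter_cons_of_neg (by simp), h1, normalLabel_filter a l, normalLabel_cons]
      split_ifs <;> simp
    · rw [List.filter_cons_of_pos (by simp [h]), normalLabel_cons, normalLabel_cons,
        normalLabel_filter m l]
      split_ifs <;> simp [h]

theorem filter_normalLabel_of_eq_zero (m : α) : ∀ (l : List α) {c : α → ℕ → ℝ},
    (∀ k, c m k = 0) → (normalLabel l c).filter (·.1 ≠ m) = normalLabel l c
  | [], c, _ => rfl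
  | a :: l, c, h => by
    have ih := filter_normalLabel_of_eq_zero m l (c := shift a c) (fun k => by
      simp only [shift]; split_ifs <;> exact h _)
    rw [normalLabel_cons]
    split_ifs with h0
    · exact ih
    · have : a ≠ m := by rintro rfl; exact h0 (h 0)
      rw [List.filter_cons_of_pos (by simp [this]), ih]

theorem mem_map_fst_normalLabel : ∀ {l : List α} {c : α → ℕ → ℝ} {i : α} {k : ℕ},
    k < l.count i → c i k ≠ 0 → i ∈ (normalLabel l c).map Prod.fst
  | [], c, i, k, h, _ => by simp at h
  | a :: l, c, i, k, h, h0 => by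
    rw [normalLabel_cons]
    by_cases hi : i = a
    · subst hi
      cases k with
      | zero => simp [h0]
      | succ k =>
        have := mem_map_fst_normalLabel (l := l) (c := shift i c) (i := i) (k := k)
          (by simpa using h) (by simpa [shift] using h0)
        split_ifs
        · exact this
        · exact List.mem_cons_of_mem _ this
    · have := mem_map_fst_normalLabel (l := l) (c := shift a c) (i := i) (k := k)
          (by simpa [List.count_cons_of_ne (Ne.symm hi)] using h) (by simpa [shift, hi] using h0)
      split_ifs
      · exact this
      · exact List.mem_cons_of_mem _ this

/-- Multiply the weights of the symbol `m` by `t`. -/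
def scale (m : α) (t : ℝ) (c : α → ℕ → ℝ) (i : α) (k : ℕ) : ℝ := if i = m then t * c i k else c i k

/-- Multiply the weights of the symbol `m` in a labelled sequence by `t`. -/
noncomputable def scaleLabel (m : α) (t : ℝ) (L : List (α × ℝ)) : List (α × ℝ) :=
  (L.map fun x => if x.1 = m then (x.1, t * x.2) else x).filter (·.2 ≠ 0)

theorem normalLabel_scale (m : α) (t : ℝ) : ∀ (l : List α) (c : α → ℕ → ℝ),
    normalLabel l (scale m t c) = scaleLabel m t (normalLabel l c)
  | [], c => rfl
  | a :: l, c => by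
    have h : shift a (scale m t c) = scale m t (shift a c) := by
      funext i k
      by_cases h1 : i = a <;> by_cases h2 : i = m <;> simp [shift, scale, h1, h2]
    rw [normalLabel_cons, normalLabel_cons, h, normalLabel_scale m t l]
    by_cases h0 : c a 0 = 0
    · simp [scale, h0]
    · by_cases h1 : a = m
      · subst h1
        by_cases ht : t = 0 <;> simp [scale, scaleLabel, h0, ht]
      · simp [scale, scaleLabel, h0, h1]

/-- The weight of the first entry, if its symbol is `m`, and `0` otherwise. -/
def leadWeight (m : α) : List (α × ℝ) → ℝ
  | [] => 0
  | x :: _ => if x.1 = m then x.2 else 0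

/-- Remove the first entry, if its symbol is `m`. -/
def dropLead (m : α) : List (α × ℝ) → List (α × ℝ)
  | [] => []
  | x :: L => if x.1 = m then L else x :: L

/-- The deformation of labelled sequences that moves the weight of `m` to the front: multiply the
weights of `m` by `1 - τ`, and put the weight `τ` on a first entry `m`. -/
noncomputable def pushLabel (m : α) (τ : ℝ) (L : List (α × ℝ)) : List (α × ℝ) :=
  if τ + (1 - τ) * leadWeight m L = 0 then scaleLabel m (1 - τ) (dropLead m L)
  else (m, τ + (1 - τ) * leadWeight m L) :: scaleLabel m (1 - τ) (dropLead m L)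

/-- The coordinates of the deformation `pushLabel` for a sequence that starts with `m`. -/
def push (m : α) (τ : ℝ) (c : α → ℕ → ℝ) (i : α) (k : ℕ) : ℝ :=
  if i = m ∧ k = 0 then τ + (1 - τ) * c i k else scale m (1 - τ) c i k

theorem normalLabel_push (m : α) (τ : ℝ) (l : List α) (c : α → ℕ → ℝ)
    (h : ∀ x ∈ (normalLabel l (shift m c)).head?, x.1 ≠ m) :
    normalLabel (m :: l) (push m τ c) = pushLabel m τ (normalLabel (m :: l) c) := by
  have h1 : shift m (push m τ c) = scale m (1 - τ) (shift m c) := by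
    funext i k
    by_cases h1 : i = m <;> simp [shift, push, scale, h1]
  have h2 : leadWeight m (normalLabel (m :: l) c) = c m 0 ∧
      dropLead m (normalLabel (m :: l) c) = normalLabel l (shift m c) := by
    rw [normalLabel_cons]
    split_ifs with h0
    · rw [h0]
      rcases hL : normalLabel l (shift m c) with _ | ⟨x, L⟩
      · simp [leadWeight, dropLead]
      · have := h x (by rw [hL]; rfl)
        simp [leadWeight, dropLead, this]
    · simp [leadWeight, dropLead]
  rw [pushLabel, h2.1, h2.2, normalLabel_cons, h1, normalLabel_scale]
  simp [push]

theorem push_zero (m : α) (c : α → ℕ → ℝ) : push m 0 c = c := by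
  funext i k
  simp [push, scale]

theorem normalLabel_push_one (m : α) (l : List α) (c : α → ℕ → ℝ) :
    normalLabel (m :: l) (push m 1 c) = (m, 1) :: (normalLabel (m :: l) c).filter (·.1 ≠ m) := by
  rw [normalLabel_cons, if_neg (by simp [push])]
  congr 1
  · simp [push]
  · rw [← normalLabel_filter, List.filter_cons_of_neg (by simp),
      ← filter_normalLabel_of_eq_zero m l (c := shift m (push m 1 c))
        (fun k => by simp [shift, push, scale]), ← normalLabel_filter]
    refine normalLabel_congr fun i k hk => ?_
    have : i ≠ m := by
      rintro rfl
      simp [List.count_eq_zero.2] at hk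
    simp [shift, push, scale, this]

end Label

/-! ### Contractibility of the subcomplexes -/

theorem contractibleSpace_of_factor {X Y : Type*} [TopologicalSpace X] [TopologicalSpace Y]
    [ContractibleSpace Y] (r : C(X, Y)) (s : C(Y, X))
    (h : (ContinuousMap.id X).Homotopic (s.comp r)) : ContractibleSpace X := by
  rw [contractible_iff_id_nullhomotopic]
  obtain ⟨y, hy⟩ := ((id_nullhomotopic Y).comp_right s).comp_left r
  exact ⟨y, h.trans hy⟩

/-- Removing `m` creates equal neighbours only where `m` is alone between two equal symbols. -/
theorem isChain_filter_ne {α : Type} [DecidableEq α] {m : α} : ∀ {l : List α},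
    l.IsChain (· ≠ ·) → (∀ i, i ≠ m → ¬ [i, m, i].Sublist l) →
    (l.filter (· ≠ m)).IsChain (· ≠ ·)
  | [], _, _ => by simp
  | a :: l, hl, h => by
    have ih := isChain_filter_ne (List.isChain_cons.1 hl).2 fun i hi h' => h i hi (h'.cons a)
    by_cases ha : a = m
    · rwa [List.filter_cons_of_neg (by simp [ha])]
    · rw [List.filter_cons_of_pos (by simp [ha]), List.isChain_cons]
      refine ⟨fun y hy => ?_, ih⟩
      rintro rfl
      rcases l with _ | ⟨b, l⟩
      · simp at hy
      · by_cases hb : b = m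
        · rw [List.filter_cons_of_neg (by simp [hb])] at hy
          have := (List.mem_filter.1 (List.mem_of_mem_head? hy)).1
          refine h a ha ?_
          rw [hb]
          exact ((List.singleton_sublist.2 this).cons_cons m).cons_cons a
        · rw [List.filter_cons_of_pos (by simp [hb])] at hy
          simp only [List.head?_cons, Option.mem_def, Option.some.injEq] at hy
          exact (List.isChain_cons.1 hl).1 b rfl hy.symm

theorem valence_of_seq_eq_cons {n : ℕ} (f : Formula n) {g : Formula n} {m i : Fin n}
    (h : g.seq = m :: f.seq) : g.valence i = f.valence i + if i = m then 1 else 0 := by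
  have h1 := f.count_seq i
  have h2 := g.count_seq i
  rw [h, List.count_cons] at h2
  by_cases hi : i = m
  · subst hi; simp at h2 ⊢; omega
  · simp [hi, Ne.symm hi] at h2 ⊢; omega

namespace OrderPair

variable {n : ℕ}

/-- The restriction of an order pair to the complement of `m`. -/
def restrict (a : OrderPair (n + 1)) (m : Fin (n + 1)) : OrderPair n where
  t i j := a.t (m.succAbove i) (m.succAbove j)
  p i j := a.p (m.succAbove i) (m.succAbove j)
  total :=
    { irrefl := fun _ => a.t_irrefl _
      trans := fun _ _ _ => a.total.trans _ _ _
      trichotomous := fun _ _ h h' => by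
        by_contra hij
        exact (a.t_total fun h => hij (Fin.succAbove_right_injective h)).elim h h' }
  partialOrd :=
    { irrefl := fun _ h => a.t_irrefl _ (a.sub _ _ h)
      trans := fun _ _ _ => a.partialOrd.trans _ _ _ }
  sub _ _ := a.sub _ _
  consistent _ _ _ := a.consistent _ _ _

theorem compatible_map_succAbove {a : OrderPair (n + 1)} {m : Fin (n + 1)} {l : List (Fin n)}
    (h : a.Compatible (l.map m.succAbove)) : (a.restrict m).Compatible l := by
  intro i j hij
  have h := h _ _ (Fin.succAbove_right_injective (p := m) |>.ne hij)
  exact ⟨fun h' => h.1 (h'.map m.succAbove), fun h' => h.2 (h'.map m.succAbove)⟩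

/-- `m` is the first symbol with respect to `t`. -/
def IsFirst (a : OrderPair n) (m : Fin n) : Prop := ∀ j, j ≠ m → a.t m j

theorem exists_isFirst (a : OrderPair (n + 1)) : ∃ m, a.IsFirst m := by
  have := a.total
  have hwf : WellFounded a.t := Finite.wellFounded_of_trans_of_irrefl a.t
  obtain ⟨m, -, hm⟩ := hwf.has_min Set.univ ⟨0, trivial⟩
  exact ⟨m, fun j hj => (a.t_total hj).resolve_left (hm j trivial)⟩

namespace IsFirst

variable {a : OrderPair n} {m : Fin n}

theorem not_p (hm : a.IsFirst m) {j : Fin n} (hj : j ≠ m) : ¬ a.p j m := fun h =>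
  a.t_asymm (hm j hj) (a.sub _ _ h)

theorem not_sublist (hm : a.IsFirst m) {l : List (Fin n)} (h : a.Compatible l) {j : Fin n}
    (hj : j ≠ m) : ¬ [j, m, j].Sublist l := fun h' => hm.not_p hj ((h j m hj).1 h')

/-- If `m` is not the first entry of the sequence of a formula, then everything to the left of
`m` may be moved into a new first argument of `m`. -/
theorem exists_cons (hm : a.IsFirst m) {f : Formula n} (hf : a.Compatible f.seq)
    (h : ∀ x ∈ f.seq.head?, x ≠ m) :
    ∃ g : Formula n, a.Compatible g.seq ∧ g.seq = m :: f.seq := by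
  obtain ⟨g, hg⟩ := Formula.exists_seq (l := m :: f.seq) ⟨by simp,
    List.isChain_cons.2 ⟨fun y hy => (h y hy).symm, f.isFormal.chain⟩, fun i j hij h' => by
      rcases List.sublist_cons_iff.1 h' with h' | ⟨s, h', hs⟩
      · exact f.isFormal.noncrossing i j hij h'
      · simp only [List.cons.injEq] at h'
        obtain ⟨rfl, rfl⟩ := h'
        exact hm.not_sublist hf hij.symm hs⟩ fun i => List.mem_cons_of_mem _ (f.mem_seq i)
  refine ⟨g, ?_, hg⟩
  rw [hg]
  intro i j hij
  constructor
  · intro h'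
    rcases List.sublist_cons_iff.1 h' with h' | ⟨s, h', hs⟩
    · exact (hf i j hij).1 h'
    · simp only [List.cons.injEq] at h'
      obtain ⟨rfl, rfl⟩ := h'
      exact ((hf j i hij.symm).2 hs).resolve_left (a.t_asymm (hm j hij.symm))
  · intro h'
    rcases List.sublist_cons_iff.1 h' with h' | ⟨s, h', hs⟩
    · exact (hf i j hij).2 h'
    · simp only [List.cons.injEq] at h'
      obtain ⟨rfl, rfl⟩ := h'
      exact Or.inl (hm j hij.symm)

/-- Every cell of the subcomplex lies in a cell of the subcomplex whose sequence starts with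
`m`. -/
theorem exists_cell (hm : a.IsFirst m) {f : Formula n} (hf : a.Compatible f.seq) :
    ∃ (g : Formula n) (l : List (Fin n)) (θ : f.Cell → g.Cell), a.Compatible g.seq ∧
      g.seq = m :: l ∧ Continuous θ ∧ ∀ x, Complex.mk f x = Complex.mk g (θ x) := by
  by_cases h : ∀ x ∈ f.seq.head?, x ≠ m
  · obtain ⟨g, hg, hgf⟩ := hm.exists_cons hf h
    have hv := fun i => valence_of_seq_eq_cons f (i := i) hgf
    have h0 : ∀ (x : f.Cell) i k, 0 ≤ insertZero m 0 (f.coord x) i k := by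
      intro x i k
      unfold insertZero
      split_ifs <;> first | exact le_rfl | exact f.coord_nonneg _ _ _
    have h1 : ∀ (x : f.Cell) i,
        ∑ k ∈ Finset.range (g.valence i + 1), insertZero m 0 (f.coord x) i k = 1 := by
      intro x i
      rw [hv, ← f.sum_coord x i]
      by_cases hi : i = m
      · subst hi
        rw [if_pos rfl, Finset.sum_range_succ']
        simp [insertZero]
      · simp [insertZero, hi]
    have hc : ∀ i k, Continuous fun x => insertZero m 0 (f.coord x) i k := by
      intro i k
      unfold insertZero
      split_ifs <;> first | exact continuous_const | exact f.continuous_coord _ _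
    refine ⟨g, f.seq, fun x => g.ofCoord _ (h0 x) (h1 x), hg, hgf,
      g.continuous_ofCoord _ h0 h1 hc, fun x => Complex.normalForm_injective ?_⟩
    rw [Complex.normalForm_mk, Complex.normalForm_mk, Formula.normalForm, Formula.normalForm]
    conv_lhs => rw [← Word.delOcc_cons_self_zero m f.seq]
    rw [normalLabel_delOcc, ← hgf]
    refine normalLabel_congr fun i k hk => ?_
    rw [Formula.count_seq] at hk
    rw [g.coord_ofCoord _ _ _ _ _ hk]
  · push Not at h
    obtain ⟨x, hx, rfl⟩ := h
    obtain ⟨l, hl⟩ := List.head?_eq_some_iff.1 hx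
    exact ⟨f, l, id, hf, hl, continuous_id, fun _ => rfl⟩

/-- After an initial entry `m`, the normal form continues with a different symbol: otherwise a
symbol would occur on both sides of `m`. -/
theorem head_normalLabel_ne (hm : a.IsFirst m) {g : Formula n} {l : List (Fin n)}
    (hg : a.Compatible g.seq) (hl : g.seq = m :: l) (x : g.Cell) :
    ∀ y ∈ (normalLabel l (shift m (g.coord x))).head?, y.1 ≠ m := by
  intro y hy hym
  obtain ⟨L, hL⟩ := List.head?_eq_some_iff.1 hy
  have hs := map_fst_normalLabel_sublist l (shift m (g.coord x))
  rcases l with _ | ⟨i, l⟩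
  · simp [normalLabel, label] at hy
  have hi : i ≠ m := by
    have := g.isFormal.chain
    rw [hl, List.isChain_cons] at this
    exact fun h => this.1 i rfl h.symm
  obtain ⟨k, hk, hk0⟩ : ∃ k < g.valence i + 1, g.coord x i k ≠ 0 := by
    by_contra h
    push Not at h
    have := g.sum_coord x i
    rw [Finset.sum_eq_zero fun k hk => h k (Finset.mem_range.1 hk)] at this
    exact zero_ne_one this
  have hmem := mem_map_fst_normalLabel (l := i :: l) (c := shift m (g.coord x)) (i := i) (k := k)
    (by rw [← g.count_seq, hl, List.count_cons_of_ne hi.symm] at hk; exact hk)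
    (by simpa [shift, hi] using hk0)
  rw [hL, List.map_cons, hym] at hmem hs
  have hmem := (List.mem_cons.1 hmem).resolve_left hi
  have h1 : [m, i].Sublist (i :: l) :=
    ((List.singleton_sublist.2 hmem).cons_cons m).trans hs
  rcases List.sublist_cons_iff.1 h1 with h1 | ⟨s, h1, -⟩
  · refine hm.not_sublist hg hi ?_
    rw [hl]
    exact (h1.cons_cons i).cons m
  · simp only [List.cons.injEq] at h1
    exact hi h1.1.symm

theorem push_nonneg {g : Formula n} (x : g.Cell) (τ : unitInterval) (i : Fin n) (k : ℕ) :
    0 ≤ push m τ (g.coord x) i k := by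
  have h1 := g.coord_nonneg x i k
  have h2 := τ.2.1
  have h3 := τ.2.2
  have h4 : 0 ≤ (1 - (τ : ℝ)) * g.coord x i k := mul_nonneg (by linarith) h1
  unfold push scale
  split_ifs <;> linarith

theorem sum_push {g : Formula n} (x : g.Cell) (τ : ℝ) (i : Fin n) :
    ∑ k ∈ Finset.range (g.valence i + 1), push m τ (g.coord x) i k = 1 := by
  have h := g.sum_coord x i
  by_cases hi : i = m
  · subst hi
    rw [Finset.sum_range_succ'] at h ⊢
    simp only [push, scale, if_true, true_and, Nat.add_eq_zero_iff, one_ne_zero, and_false,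
      if_false, ← Finset.mul_sum]
    linear_combination (1 - τ) * h
  · simpa [push, scale, hi] using h

/-- The deformation of a cell whose sequence starts with `m`: the coordinates of `m` move to the
first vertex. -/
noncomputable def pushMap (m : Fin n) (g : Formula n) (q : g.Cell × unitInterval) : g.Cell :=
  g.ofCoord (push m q.2 (g.coord q.1)) (push_nonneg q.1 q.2) (sum_push q.1 q.2)

theorem continuous_pushMap (g : Formula n) : Continuous (pushMap m g) := by
  refine g.continuous_ofCoord _ _ _ fun i k => ?_
  have h1 : Continuous fun q : g.Cell × unitInterval => g.coord q.1 i k :=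
    (g.continuous_coord i k).comp continuous_fst
  have h2 : Continuous fun q : g.Cell × unitInterval => (q.2 : ℝ) :=
    continuous_subtype_val.comp continuous_snd
  unfold push scale
  split_ifs <;> fun_prop

theorem normalForm_pushMap_eq {g : Formula n} (q : g.Cell × unitInterval) :
    g.normalForm (pushMap m g q) = normalLabel g.seq (push m q.2 (g.coord q.1)) :=
  normalLabel_congr fun i k hk => by
    rw [g.count_seq] at hk
    exact g.coord_ofCoord _ _ _ _ _ hk

theorem normalForm_pushMap (hm : a.IsFirst m) {g : Formula n} {l : List (Fin n)}
    (hg : a.Compatible g.seq) (hl : g.seq = m :: l) (q : g.Cell × unitInterval) :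
    g.normalForm (pushMap m g q) = pushLabel m q.2 (g.normalForm q.1) := by
  rw [normalForm_pushMap_eq, Formula.normalForm, hl]
  exact normalLabel_push _ _ _ _ (hm.head_normalLabel_ne hg hl q.1)

/-- The path in the subcomplex from a point of a cell whose sequence starts with `m`. -/
noncomputable def pushPath (m : Fin n) {a : OrderPair n} {g : Formula n}
    (hg : a.Compatible g.seq) : C(g.Cell, C(unitInterval, subcomplex a)) :=
  ContinuousMap.curry ⟨fun q => ⟨Complex.mk g (pushMap m g q), mk_mem_subcomplex hg _⟩,
    Continuous.subtype_mk ((Complex.continuous_mk g).comp (continuous_pushMap g)) _⟩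

/-- The deformation of the subcomplex that moves the coordinates of `m` to the first place. -/
theorem exists_homotopy (hm : a.IsFirst m) :
    ∃ Φ : C(subcomplex a, C(unitInterval, subcomplex a)),
      (∀ y, Φ y 0 = y) ∧ ∀ y, (Φ y 1).1.normalForm =
        (m, 1) :: y.1.normalForm.filter (·.1 ≠ m) := by
  have key : ∀ y : subcomplex a, ∃ (g : Formula n) (l : List (Fin n)) (_ : g.seq = m :: l)
      (hg : a.Compatible g.seq) (x : g.Cell), y.1 = Complex.mk g x := by
    intro y
    obtain ⟨f, x, hf, hy⟩ := mem_subcomplex.1 y.2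
    obtain ⟨g, l, θ, hg, hl, -, hθ⟩ := hm.exists_cell hf
    exact ⟨g, l, hl, hg, θ x, by rw [hy, hθ]⟩
  choose G l hl hG X hX using key
  have spec : ∀ (g : Formula n) (l : List (Fin n)) (_ : g.seq = m :: l)
      (hg : a.Compatible g.seq) (x : g.Cell) (τ : unitInterval),
      (pushPath m hg x τ).1.normalForm = pushLabel m τ (Complex.mk g x).normalForm :=
    fun g l hl hg x τ => hm.normalForm_pushMap hg hl (x, τ)
  -- The paths are independent of the choice of the cell, because their normal forms are.
  refine ⟨⟨fun y => pushPath m (hG y) (X y), continuous_of_cells _ fun f hf => ?_⟩,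
    fun y => ?_, fun y => ?_⟩
  · obtain ⟨g, l', θ, hg, hl', hθ, h⟩ := hm.exists_cell hf
    convert (pushPath m hg).continuous.comp hθ using 1
    funext x
    ext τ : 1
    apply Subtype.ext
    apply Complex.normalForm_injective
    rw [spec _ _ (hl _), Function.comp_apply, spec _ _ hl', ← hX, ← h]
  · apply Subtype.ext
    apply Complex.normalForm_injective
    rw [hX y]
    refine (normalForm_pushMap_eq (X y, 0)).trans ?_
    simp only [Set.Icc.coe_zero, push_zero]
    rfl
  · rw [hX y]
    refine (normalForm_pushMap_eq (X y, 1)).trans ?_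
    rw [Complex.normalForm_mk, Formula.normalForm, hl, Set.Icc.coe_one]
    exact normalLabel_push_one _ _ _

end IsFirst

section Remove

variable {a : OrderPair (n + 1)} {m : Fin (n + 1)}

theorem map_succAbove_injective (m : Fin (n + 1)) : Function.Injective
    (List.map (Prod.map m.succAbove id) : List (Fin n × ℝ) → List (Fin (n + 1) × ℝ)) :=
  List.map_injective_iff.2 (Fin.succAbove_right_injective.prodMap Function.injective_id)

/-- The formula obtained by removing the symbol `m`. -/
theorem IsFirst.exists_remove (hn : 0 < n) (hm : a.IsFirst m) {f : Formula (n + 1)}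
    (hf : a.Compatible f.seq) : ∃ g : Formula n, (a.restrict m).Compatible g.seq ∧
      g.seq.map m.succAbove = f.seq.filter (· ≠ m) := by
  have h1 : f.seq.filter (· ≠ m) ∈ Set.range (List.map m.succAbove) := by
    rw [Set.range_list_map]
    intro x hx
    exact Fin.exists_succAbove_eq (by simpa using (List.mem_filter.1 hx).2)
  obtain ⟨l, hl⟩ := h1
  have hmem : ∀ i, i ∈ l := by
    intro i
    have : m.succAbove i ∈ l.map m.succAbove := by
      rw [hl, List.mem_filter]
      exact ⟨f.mem_seq _, by simp [Fin.succAbove_ne]⟩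
    exact (List.mem_map_of_injective Fin.succAbove_right_injective).1 this
  have hs : (l.map m.succAbove).Sublist f.seq := by rw [hl]; exact List.filter_sublist
  obtain ⟨g, hg⟩ := Formula.exists_seq (l := l) ⟨List.ne_nil_of_mem (hmem ⟨0, hn⟩), by
      have h := isChain_filter_ne f.isFormal.chain fun i hi => hm.not_sublist hf hi
      rw [← hl, List.isChain_map] at h
      exact h.imp fun x y hxy h => hxy (congrArg _ h), fun i j hij h =>
      f.isFormal.noncrossing _ _ (Fin.succAbove_right_injective (p := m) |>.ne hij)
        ((h.map m.succAbove).trans hs)⟩ hmem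
  refine ⟨g, ?_, by rw [hg, hl]⟩
  rw [hg]
  exact compatible_map_succAbove (hf.sublist hs)

theorem valence_of_map_eq_filter {f : Formula (n + 1)} {g : Formula n}
    (h : g.seq.map m.succAbove = f.seq.filter (· ≠ m)) (i : Fin n) :
    g.valence i = f.valence (m.succAbove i) := by
  have h1 := g.count_seq i
  have h2 := f.count_seq (m.succAbove i)
  have h3 := congrArg (List.count (m.succAbove i)) h
  rw [List.count_map_of_injective _ _ Fin.succAbove_right_injective,
    List.count_filter (by simp [Fin.succAbove_ne])] at h3
  omega

/-- Removing the first symbol `m` is a continuous map of subcomplexes. -/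
theorem IsFirst.exists_removeMap (hn : 0 < n) (hm : a.IsFirst m) :
    ∃ r : C(subcomplex a, subcomplex (a.restrict m)), ∀ y,
      (r y).1.normalForm.map (Prod.map m.succAbove id) = y.1.normalForm.filter (·.1 ≠ m) := by
  have key : ∀ (f : Formula (n + 1)), a.Compatible f.seq →
      ∃ R : C(f.Cell, subcomplex (a.restrict m)), ∀ x,
        (R x).1.normalForm.map (Prod.map m.succAbove id) =
          (Complex.mk f x).normalForm.filter (·.1 ≠ m) := by
    intro f hf
    obtain ⟨g, hg, hgf⟩ := hm.exists_remove hn hf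
    have hv := valence_of_map_eq_filter hgf
    have h1 : ∀ (x : f.Cell) i, ∑ k ∈ Finset.range (g.valence i + 1),
        f.coord x (m.succAbove i) k = 1 := fun x i => by rw [hv, f.sum_coord]
    refine ⟨⟨fun x => ⟨Complex.mk g (g.ofCoord (fun i k => f.coord x (m.succAbove i) k)
      (fun i k => f.coord_nonneg _ _ _) (h1 x)), mk_mem_subcomplex hg _⟩,
      Continuous.subtype_mk ((Complex.continuous_mk g).comp
        (g.continuous_ofCoord _ _ _ fun i k => f.continuous_coord _ _)) _⟩, fun x => ?_⟩
    simp only [ContinuousMap.coe_mk, Complex.normalForm_mk, Formula.normalForm]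
    rw [← normalLabel_filter, ← hgf,
      normalLabel_map Fin.succAbove_right_injective g.seq (fun i k => rfl)]
    congr 1
    refine normalLabel_congr fun i k hk => ?_
    rw [g.count_seq] at hk
    exact g.coord_ofCoord _ _ _ _ _ hk
  choose R hR using key
  have key2 : ∀ y : subcomplex a, ∃ z : subcomplex (a.restrict m),
      z.1.normalForm.map (Prod.map m.succAbove id) = y.1.normalForm.filter (·.1 ≠ m) := by
    intro y
    obtain ⟨f, x, hf, hy⟩ := mem_subcomplex.1 y.2
    exact ⟨R f hf x, by rw [hy, hR]⟩
  choose r hr using key2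
  refine ⟨⟨r, continuous_of_cells r fun f hf => ?_⟩, hr⟩
  convert (R f hf).continuous using 1
  funext x
  apply Subtype.ext
  apply Complex.normalForm_injective
  apply map_succAbove_injective m
  rw [hr, hR]

theorem notMem_map_succAbove (m : Fin (n + 1)) (l : List (Fin n)) : m ∉ l.map m.succAbove := by
  simp [Fin.succAbove_ne]

theorem exists_sublist_of_sublist_map {l : List (Fin n)} {s : List (Fin (n + 1))}
    (h : s.Sublist (l.map m.succAbove)) :
    ∃ s' : List (Fin n), s'.Sublist l ∧ s = s'.map m.succAbove :=
  List.sublist_map_iff.1 h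

/-- The formula `m ⌣ g`. -/
theorem IsFirst.exists_prepend (hm : a.IsFirst m) {g : Formula n}
    (hg : (a.restrict m).Compatible g.seq) : ∃ f : Formula (n + 1), a.Compatible f.seq ∧
      f.seq = m :: g.seq.map m.succAbove := by
  have hmm := notMem_map_succAbove m g.seq
  obtain ⟨f, hf⟩ := Formula.exists_seq (l := m :: g.seq.map m.succAbove) ⟨by simp, by
      rw [List.isChain_cons, List.isChain_map]
      refine ⟨fun y hy => ?_, g.isFormal.chain.imp fun x y hxy h =>
        hxy (Fin.succAbove_right_injective h)⟩
      rintro rfl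
      exact hmm (List.mem_of_mem_head? hy), fun i j hij h => by
      rcases List.sublist_cons_iff.1 h with h | ⟨s, h, hs⟩
      · obtain ⟨s', hs', h⟩ := exists_sublist_of_sublist_map h
        rcases s' with _ | ⟨x, _ | ⟨y, _ | ⟨z, _ | ⟨w, _ | _⟩⟩⟩⟩ <;> simp at h
        obtain ⟨rfl, rfl, h1, h2⟩ := h
        rw [Fin.succAbove_right_injective.eq_iff] at h1 h2
        subst h1 h2
        exact g.isFormal.noncrossing x y (fun h => hij (congrArg _ h)) hs'
      · simp only [List.cons.injEq] at h
        obtain ⟨rfl, rfl⟩ := h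
        exact hmm (hs.subset (by simp))⟩ fun i => by
      rcases Fin.eq_self_or_eq_succAbove m i with rfl | ⟨i, rfl⟩
      · simp
      · exact List.mem_cons_of_mem _ (List.mem_map_of_mem (g.mem_seq i))
  refine ⟨f, ?_, hf⟩
  rw [hf]
  intro i j hij
  constructor
  · intro h
    rcases List.sublist_cons_iff.1 h with h | ⟨s, h, hs⟩
    · obtain ⟨s', hs', h⟩ := exists_sublist_of_sublist_map h
      rcases s' with _ | ⟨x, _ | ⟨y, _ | ⟨z, _ | _⟩⟩⟩ <;> simp at h
      obtain ⟨rfl, rfl, h1⟩ := h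
      rw [Fin.succAbove_right_injective.eq_iff] at h1
      subst h1
      exact (hg x y (fun h => hij (congrArg _ h))).1 hs'
    · simp only [List.cons.injEq] at h
      obtain ⟨rfl, rfl⟩ := h
      exact (hmm (hs.subset (by simp))).elim
  · intro h
    rcases List.sublist_cons_iff.1 h with h | ⟨s, h, hs⟩
    · obtain ⟨s', hs', h⟩ := exists_sublist_of_sublist_map h
      rcases s' with _ | ⟨x, _ | ⟨y, _ | _⟩⟩ <;> simp at h
      obtain ⟨rfl, rfl⟩ := h
      exact (hg x y (fun h => hij (congrArg _ h))).2 hs'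
    · simp only [List.cons.injEq] at h
      obtain ⟨rfl, rfl⟩ := h
      exact Or.inl (hm j hij.symm)

/-- Multiplication with the first symbol `m` from the left is a continuous map of
subcomplexes. -/
theorem IsFirst.exists_prependMap (hm : a.IsFirst m) :
    ∃ s : C(subcomplex (a.restrict m), subcomplex a), ∀ y,
      (s y).1.normalForm = (m, 1) :: y.1.normalForm.map (Prod.map m.succAbove id) := by
  have key : ∀ (g : Formula n), (a.restrict m).Compatible g.seq →
      ∃ S : C(g.Cell, subcomplex a), ∀ x,
        (S x).1.normalForm =
          (m, 1) :: (Complex.mk g x).normalForm.map (Prod.map m.succAbove id) := by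
    intro g hg
    obtain ⟨f, hf, hfg⟩ := hm.exists_prepend hg
    have hvm : f.valence m = 0 := by
      have := f.count_seq m
      rw [hfg, List.count_cons_self, List.count_eq_zero.2 (notMem_map_succAbove m g.seq)] at this
      omega
    have hv : ∀ i, f.valence (m.succAbove i) = g.valence i := by
      intro i
      have h1 := f.count_seq (m.succAbove i)
      have h2 := g.count_seq i
      rw [hfg, List.count_cons_of_ne (Fin.succAbove_ne m i).symm,
        List.count_map_of_injective _ _ Fin.succAbove_right_injective] at h1
      omega
    set c : g.Cell → Fin (n + 1) → ℕ → ℝ := fun x =>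
      m.insertNth (α := fun _ => ℕ → ℝ) (fun _ => 1) (g.coord x) with hc
    have cm : ∀ x k, c x m k = 1 := fun x k => by simp [hc]
    have cs : ∀ x i k, c x (m.succAbove i) k = g.coord x i k := fun x i k => by simp [hc]
    have h0 : ∀ x i k, 0 ≤ c x i k := by
      intro x i k
      rcases Fin.eq_self_or_eq_succAbove m i with rfl | ⟨i, rfl⟩
      · rw [cm]; exact zero_le_one
      · rw [cs]; exact g.coord_nonneg _ _ _
    have h1 : ∀ x i, ∑ k ∈ Finset.range (f.valence i + 1), c x i k = 1 := by
      intro x i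
      rcases Fin.eq_self_or_eq_succAbove m i with rfl | ⟨i, rfl⟩
      · simp [hvm, cm]
      · simp only [hv, cs]; exact g.sum_coord _ _
    have hcont : ∀ i k, Continuous fun x => c x i k := by
      intro i k
      rcases Fin.eq_self_or_eq_succAbove m i with rfl | ⟨i, rfl⟩
      · simp only [cm]; exact continuous_const
      · simp only [cs]; exact g.continuous_coord _ _
    refine ⟨⟨fun x => ⟨Complex.mk f (f.ofCoord (c x) (h0 x) (h1 x)), mk_mem_subcomplex hf _⟩,
      Continuous.subtype_mk ((Complex.continuous_mk f).comp
        (f.continuous_ofCoord _ _ _ hcont)) _⟩, fun x => ?_⟩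
    simp only [ContinuousMap.coe_mk, Complex.normalForm_mk, Formula.normalForm]
    have h2 : normalLabel f.seq (f.coord (f.ofCoord (c x) (h0 x) (h1 x))) =
        normalLabel f.seq (c x) := normalLabel_congr fun i k hk => by
      rw [f.count_seq] at hk
      exact f.coord_ofCoord _ _ _ _ _ hk
    rw [h2, hfg, normalLabel_cons, cm, if_neg one_ne_zero]
    congr 1
    refine normalLabel_map Fin.succAbove_right_injective g.seq fun i k => ?_
    simp [shift, Fin.succAbove_ne, cs]
  choose S hS using key
  have key2 : ∀ y : subcomplex (a.restrict m), ∃ z : subcomplex a,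
      z.1.normalForm = (m, 1) :: y.1.normalForm.map (Prod.map m.succAbove id) := by
    intro y
    obtain ⟨f, x, hf, hy⟩ := mem_subcomplex.1 y.2
    exact ⟨S f hf x, by rw [hy, hS]⟩
  choose s hs using key2
  refine ⟨⟨s, continuous_of_cells s fun f hf => ?_⟩, hs⟩
  convert (S f hf).continuous using 1
  funext x
  apply Subtype.ext
  apply Complex.normalForm_injective
  rw [hs, hS]

/-- The subcomplex of `a` deforms into the image of the subcomplex of the restriction of `a` to
the complement of the first symbol. -/
theorem contractibleSpace_of_restrict (hn : 0 < n) (hm : a.IsFirst m)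
    (h : ContractibleSpace (subcomplex (a.restrict m))) : ContractibleSpace (subcomplex a) := by
  obtain ⟨r, hr⟩ := hm.exists_removeMap hn
  obtain ⟨s, hs⟩ := hm.exists_prependMap
  obtain ⟨Φ, h0, h1⟩ := hm.exists_homotopy
  refine contractibleSpace_of_factor r s ⟨?_⟩
  refine
    { toFun := fun q => Φ q.2 q.1
      continuous_toFun := Φ.uncurry.continuous.comp continuous_swap
      map_zero_left := fun y => h0 y
      map_one_left := fun y => ?_ }
  apply Subtype.ext
  apply Complex.normalForm_injective
  rw [h1, ContinuousMap.comp_apply, hs, hr]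

end Remove

theorem seq_eq_singleton (f : Formula 1) : f.seq = [0] := by
  have h1 := f.isFormal.ne_nil
  have h2 := f.isFormal.chain
  rcases h : f.seq with _ | ⟨i, _ | ⟨j, l⟩⟩
  · exact (h1 h).elim
  · rw [Subsingleton.elim i 0]
  · rw [h, List.isChain_cons] at h2
    exact (h2.1 j rfl (Subsingleton.elim _ _)).elim

instance : Subsingleton (Complex 1) := by
  refine ⟨fun y z => ?_⟩
  obtain ⟨f, x, rfl⟩ := y.exists_mk
  obtain ⟨g, x', rfl⟩ := z.exists_mk
  have : f = g := Formula.seq_injective (by rw [seq_eq_singleton, seq_eq_singleton])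
  subst this
  congr 1
  funext i
  have : f.valence i = 0 := by
    rw [Subsingleton.elim i 0]
    have := f.count_seq 0
    rw [seq_eq_singleton] at this
    simpa using this.symm
  have : Subsingleton (Fin (f.valence i + 1)) := by
    rw [this]
    exact inferInstanceAs (Subsingleton (Fin 1))
  exact Subsingleton.elim _ _

theorem contractibleSpace_subcomplex : ∀ (n : ℕ) (a : OrderPair (n + 1)),
    ContractibleSpace (subcomplex a)
  | 0, a => by
    obtain ⟨f, hf⟩ := Formula.exists_seq (n := 1) (l := [0])
      ⟨by simp, by simp, fun i j hij => (hij (Subsingleton.elim (α := Fin 1) _ _)).elim⟩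
      (fun i => by simp [Subsingleton.elim i 0])
    have hc : a.Compatible f.seq := fun i j hij =>
      (hij (Subsingleton.elim (α := Fin 1) _ _)).elim
    have : Nonempty (subcomplex a) :=
      ⟨⟨Complex.mk f (Classical.arbitrary _), mk_mem_subcomplex hc _⟩⟩
    have : Subsingleton (subcomplex a) := inferInstanceAs (Subsingleton {y : Complex 1 // _})
    infer_instance
  | n + 1, a => by
    obtain ⟨m, hm⟩ := a.exists_isFirst
    exact contractibleSpace_of_restrict (Nat.succ_pos n) hm (contractibleSpace_subcomplex n _)

end OrderPair

/-! ### The open cover of the configuration space -/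

namespace OrderPair

variable {n : ℕ}

/-- The condition on `n` points of the plane that defines the open set of `a`: for `i < j` in `t`,
the second coordinates are in the order of `t`, unless `i < j` in `p`; in that case it is only
excluded that the second coordinates agree and the first ones are not in the order of `t`. -/
def InRegion (a : OrderPair n) (x : Fin n → ℝ × ℝ) : Prop :=
  ∀ i j, a.t i j → (x i).2 < (x j).2 ∨ a.p i j ∧ ((x j).2 < (x i).2 ∨ (x i).1 < (x j).1)

theorem InRegion.injective {a : OrderPair n} {x : Fin n → ℝ × ℝ} (h : a.InRegion x) :
    Function.Injective x := by
  have key : ∀ i j, a.t i j → x i ≠ x j := by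
    intro i j hij he
    have := h i j hij
    simp [he] at this
  intro i j he
  by_contra hij
  exact (a.t_total hij).elim (fun h => key i j h he) fun h => key j i h he.symm

/-- The open subspaces of the configuration space that correspond to order pairs. -/
def region : OrderPair n →o Set (Configuration n) where
  toFun a := {x | a.InRegion x}
  monotone' a b hab x hx i j hij := by
    have hne : i ≠ j := by rintro rfl; exact b.t_irrefl _ hij
    rcases a.t_total hne with h | h
    · exact (hx i j h).imp id fun h' => ⟨hab.1 _ _ h'.1, h'.2⟩
    · rcases hx j i h with h' | h'
      · exact Or.inr ⟨hab.2 _ _ hij h, Or.inl h'⟩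
      · exact (b.t_asymm hij (b.sub _ _ (hab.1 _ _ h'.1))).elim

theorem isOpen_region (a : OrderPair n) : IsOpen (region a) := by
  have : region a = ⋂ (i : Fin n), ⋂ (j : Fin n), ⋂ (_ : a.t i j),
      {x : Configuration n | (x.1 i).2 < (x.1 j).2} ∪ ⋃ (_ : a.p i j),
        ({x : Configuration n | (x.1 j).2 < (x.1 i).2} ∪
          {x : Configuration n | (x.1 i).1 < (x.1 j).1}) := by
    ext x
    simp [region, InRegion]
  rw [this]
  have h1 : ∀ i, Continuous fun x : Configuration n => (x.1 i).1 := fun i =>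
    continuous_fst.comp ((continuous_apply i).comp continuous_subtype_val)
  have h2 : ∀ i, Continuous fun x : Configuration n => (x.1 i).2 := fun i =>
    continuous_snd.comp ((continuous_apply i).comp continuous_subtype_val)
  exact isOpen_iInter_of_finite fun i => isOpen_iInter_of_finite fun j =>
    isOpen_iInter_of_finite fun _ => (isOpen_lt (h2 i) (h2 j)).union
      (isOpen_iUnion fun _ => (isOpen_lt (h2 j) (h2 i)).union (isOpen_lt (h1 i) (h1 j)))

end OrderPair

/-- The smallest order pair whose region contains a configuration: `t` is the lexicographic order
with the second coordinate first, and `p` relates points with the same second coordinate. -/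
def Configuration.orderPair {n : ℕ} (x : Configuration n) : OrderPair n where
  t i j := (x.1 i).2 < (x.1 j).2 ∨ (x.1 i).2 = (x.1 j).2 ∧ (x.1 i).1 < (x.1 j).1
  p i j := (x.1 i).2 = (x.1 j).2 ∧ (x.1 i).1 < (x.1 j).1
  total :=
    { irrefl := fun i h => by simp at h
      trans := fun i j k h h' => by
        rcases h with h | h <;> rcases h' with h' | h'
        · exact Or.inl (h.trans h')
        · exact Or.inl (h'.1 ▸ h)
        · exact Or.inl (h.1 ▸ h')
        · exact Or.inr ⟨h.1.trans h'.1, h.2.trans h'.2⟩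
      trichotomous := fun i j h h' => by
        push Not at h h'
        have h2 := le_antisymm h'.1 h.1
        exact x.2 (Prod.ext (le_antisymm (h'.2 h2.symm) (h.2 h2)) h2) }
  partialOrd :=
    { irrefl := fun i h => lt_irrefl _ h.2
      trans := fun i j k h h' => ⟨h.1.trans h'.1, h.2.trans h'.2⟩ }
  sub i j h := Or.inr h
  consistent i j k h h' hp := by
    rcases h with h | h
    · rcases h' with h' | h'
      · exact ((h.trans h').ne hp.1).elim
      · exact ((h.trans_eq h'.1).ne hp.1).elim
    · exact h

namespace OrderPair

variable {n : ℕ}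

theorem mem_region_orderPair (x : Configuration n) : x ∈ region x.orderPair := by
  rintro i j (h | h)
  · exact Or.inl h
  · exact Or.inr ⟨h, Or.inr h.2⟩

theorem orderPair_le_of_mem_region {a : OrderPair n} {x : Configuration n} (hx : x ∈ region a) :
    x.orderPair ≤ a := by
  refine ⟨fun i j h => ?_, fun i j h h' => ?_⟩
  · have hij : i ≠ j := by rintro rfl; exact lt_irrefl _ h.2
    rcases a.t_total hij with ht | ht
    · exact ((hx i j ht).resolve_left h.1.not_lt).1
    · rcases hx j i ht with h1 | ⟨-, h1 | h1⟩
      · exact (h1.ne h.1.symm).elim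
      · exact (h1.ne h.1).elim
      · exact (lt_asymm h1 h.2).elim
  · refine ((hx i j h).resolve_left ?_).1
    rcases h' with h' | h'
    · exact h'.not_gt
    · exact h'.1.symm.not_lt

theorem iUnion_region : (⋃ a : OrderPair n, region a) = Set.univ :=
  Set.eq_univ_iff_forall.2 fun x => Set.mem_iUnion.2 ⟨_, mem_region_orderPair x⟩

theorem isColimit_region :
    Nonempty (IsColimit (subspaceCocone (region : OrderPair n →o Set (Configuration n)))) := by
  refine isColimit_subspaceCocone _ (fun x => x.orderPair) mem_region_orderPair
    (fun x a h => orderPair_le_of_mem_region h) fun Z _ g hg => ?_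
  rw [continuous_iff_continuousAt]
  intro x
  exact (continuousOn_iff_continuous_domRestrict.2 (hg x.orderPair)).continuousAt
    ((isOpen_region _).mem_nhds (mem_region_orderPair x))

/-- The position of a symbol in the order `t`. -/
noncomputable def rank (a : OrderPair n) (i : Fin n) : ℝ := (Set.ncard {k | a.t k i} : ℝ)

theorem rank_lt (a : OrderPair n) {i j : Fin n} (h : a.t i j) : a.rank i < a.rank j := by
  unfold rank
  rw [Nat.cast_lt]
  refine Set.ncard_lt_ncard ⟨fun k hk => a.total.trans _ _ _ hk h, fun hs => ?_⟩
  exact a.t_irrefl i (hs h)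

theorem mix_lt {τ u v r s : ℝ} (h0 : 0 ≤ τ) (h1 : τ ≤ 1) (huv : u < v) (hrs : r < s) :
    (1 - τ) * u + τ * r < (1 - τ) * v + τ * s := by
  rcases h0.eq_or_lt with rfl | h0
  · simpa using huv
  · have := mul_le_mul_of_nonneg_left huv.le (sub_nonneg.2 h1)
    have := mul_lt_mul_of_pos_left hrs h0
    linarith

/-- Two maps into a region are homotopic if they are joined by a continuous family of `n`-tuples
in the region. -/
theorem homotopic_of_inRegion {a : OrderPair n} (f g : C(region a, region a))
    (F : unitInterval × region a → Fin n → ℝ × ℝ) (hF : Continuous F)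
    (h : ∀ q, a.InRegion (F q)) (h0 : ∀ x, F (0, x) = (f x).1.1)
    (h1 : ∀ x, F (1, x) = (g x).1.1) : f.Homotopic g :=
  ⟨{ toFun := fun q => ⟨⟨F q, (h q).injective⟩, h q⟩
     continuous_toFun := Continuous.subtype_mk (Continuous.subtype_mk hF _) _
     map_zero_left := fun x => Subtype.ext (Subtype.ext (h0 x))
     map_one_left := fun x => Subtype.ext (Subtype.ext (h1 x)) }⟩

/-- A region is contractible: the first coordinates can be moved linearly to the ranks with
respect to `t`; after that, the second coordinates are only subject to convex conditions. -/
theorem contractibleSpace_region (a : OrderPair n) : ContractibleSpace (region a) := by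
  have hb : ∀ (i j : Fin n) (y : Fin n → ℝ), a.t i j → (y i < y j ∨ a.p i j) →
      (y i < y j ∨ a.p i j ∧ (y j < y i ∨ a.rank i < a.rank j)) :=
    fun i j y ht h => h.imp id fun h => ⟨h, Or.inr (a.rank_lt ht)⟩
  have hG : ∀ x : region a, a.InRegion fun i => (a.rank i, (x.1.1 i).2) := fun x i j ht =>
    hb i j (fun i => (x.1.1 i).2) ht ((x.2 i j ht).imp id And.left)
  have hc : a.InRegion fun i => (a.rank i, a.rank i) := fun i j ht => Or.inl (a.rank_lt ht)
  have c0 : ∀ i, Continuous fun x : region a => x.1.1 i := fun i =>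
    (continuous_apply i).comp (continuous_subtype_val.comp continuous_subtype_val)
  have c1 : ∀ i, Continuous fun q : unitInterval × region a => (q.2.1.1 i).1 := fun i =>
    continuous_fst.comp ((c0 i).comp continuous_snd)
  have c2 : ∀ i, Continuous fun q : unitInterval × region a => (q.2.1.1 i).2 := fun i =>
    continuous_snd.comp ((c0 i).comp continuous_snd)
  let G : C(region a, region a) := ⟨fun x => ⟨⟨_, (hG x).injective⟩, hG x⟩,
    Continuous.subtype_mk (Continuous.subtype_mk (continuous_pi fun i =>
      continuous_const.prodMk (continuous_snd.comp (c0 i))) _) _⟩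
  rw [contractible_iff_id_nullhomotopic]
  refine ⟨⟨⟨_, hc.injective⟩, hc⟩, ContinuousMap.Homotopic.trans (g := G) ?_ ?_⟩
  · refine homotopic_of_inRegion _ _
      (fun q i => ((1 - (q.1 : ℝ)) * (q.2.1.1 i).1 + q.1 * a.rank i, (q.2.1.1 i).2))
      (continuous_pi fun i => ?_) (fun q i j ht => ?_) (fun x => ?_) (fun x => ?_)
    · have := c1 i
      have := c2 i
      fun_prop
    · exact (q.2.2 i j ht).imp id fun h => ⟨h.1, h.2.imp id fun h =>
        mix_lt q.1.2.1 q.1.2.2 h (a.rank_lt ht)⟩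
    · funext i
      simp
    · funext i
      simp [G]
  · refine homotopic_of_inRegion _ _
      (fun q i => (a.rank i, (1 - (q.1 : ℝ)) * (q.2.1.1 i).2 + q.1 * a.rank i))
      (continuous_pi fun i => ?_) (fun q i j ht => ?_) (fun x => ?_) (fun x => ?_)
    · have := c2 i
      fun_prop
    · refine hb i j (fun i => (1 - (q.1 : ℝ)) * (q.2.1.1 i).2 + q.1 * a.rank i) ht ?_
      exact (q.2.2 i j ht).imp (fun h => mix_lt q.1.2.1 q.1.2.2 h (a.rank_lt ht)) And.left
    · funext i
      simp [G]
    · funext i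
      simp

end OrderPair

end FormulaComplex

theorem proposition8p2 (n : ℕ) (hn : 0 < n) :
    (∃ I : FormulaComplex.OrderPair n →o Set (FormulaComplex.Configuration n),
      (∀ a, IsOpen (I a)) ∧ (⋃ a, I a) = Set.univ ∧
      Nonempty (CategoryTheory.Limits.IsColimit (FormulaComplex.subspaceCocone I)) ∧
      ∀ a, ContractibleSpace (I a)) ∧
    (∃ I' : FormulaComplex.OrderPair n →o Set (FormulaComplex.Complex n),
      (∀ a, FormulaComplex.IsSubcomplex (I' a)) ∧ (⋃ a, I' a) = Set.univ ∧
      Nonempty (CategoryTheory.Limits.IsColimit (FormulaComplex.subspaceCocone I')) ∧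
      ∀ a, ContractibleSpace (I' a)) := by
  refine ⟨⟨FormulaComplex.OrderPair.region, FormulaComplex.OrderPair.isOpen_region,
    FormulaComplex.OrderPair.iUnion_region, FormulaComplex.OrderPair.isColimit_region,
    FormulaComplex.OrderPair.contractibleSpace_region⟩,
    ⟨FormulaComplex.OrderPair.subcomplex, FormulaComplex.OrderPair.isSubcomplex_subcomplex,
    FormulaComplex.OrderPair.iUnion_subcomplex, FormulaComplex.OrderPair.isColimit_subcomplex,
    fun a => ?_⟩⟩
  obtain ⟨n, rfl⟩ := Nat.exists_eq_succ_of_ne_zero hn.ne'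
  exact FormulaComplex.OrderPair.contractibleSpace_subcomplex n a
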